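/- All graphs are finite and simple. A \emph{double subdivision} of an edge $pq$ of a graph $G$ produces the graph obtained from $G-pq$ by adding two new vertices and joining both of them to $p$ and $q$. A \emph{generalised triangle} is $K_3$ or any graph (up to isomorphism) obtained from $K_3$ by a sequence of double subdivisions. A \emph{2-cut} of $G$ is a set $\{x,y\}$ of two distinct vertices whose removal increases the number of components; an $\{x,y\}$-\emph{bridge} is a subgraph $G[V(C)\cup\{x,y\}]$ with $C$ a connected component of $G-\{x,y\}$, and it is \emph{trivial} if it has exactly three vertices. Let $\mathcal{K}_2$ be the class of generalised triangles $G$ such that, for every 2-cut $\{x,y\}$ of $G$, at least one $\{x,y\}$-bridge is trivial. Consider $K_{2,3}$ with parts $\{x,y\}$ and $\{u,v,w\}$; let $H_1$ be the graph formed from it by doubly subdividing the edges $xu,xv,xw$, and let $H_2$ be the graph formed from it by doubly subdividing the edges $xu,xv,yw$. Lemma. If $G$ is a generalised triangle, then $G\in\mathcal{K}_2$ if and only if $G$ is $\{H_1,H_2\}$-minor-free, i.e. neither $H_1$ nor $H_2$ is a minor of $G$. -/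

import Mathlib

namespace GenTriangle

universe u v

/-- The double subdivision of `G` at `pq` (meant for an edge `pq` of `G`): remove the edge `pq`,
add two new vertices, and join both of them to `p` and to `q`. -/
def doubleSubdivision {V : Type u} (G : SimpleGraph V) (p q : V) : SimpleGraph (V ⊕ Fin 2) where
  Adj a b :=
    match a, b with
    | Sum.inl a, Sum.inl b => (G.deleteEdges {s(p, q)}).Adj a b
    | Sum.inl a, Sum.inr _ => a = p ∨ a = q
    | Sum.inr _, Sum.inl b => b = p ∨ b = q
    | Sum.inr _, Sum.inr _ => False
  symm := ⟨by
    rintro (a | i) (b | j) h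
    · exact SimpleGraph.Adj.symm (G := G.deleteEdges {s(p, q)}) h
    · exact h
    · exact h
    · exact h⟩
  loopless := ⟨by
    rintro (a | i) h
    · exact (G.deleteEdges {s(p, q)}).loopless.irrefl a h
    · exact h⟩

/-- Generalised triangles: the graphs isomorphic to `K₃`, or obtained (up to isomorphism) from it
by a sequence of double subdivisions of edges. -/
inductive IsGeneralisedTriangle : {V : Type u} → SimpleGraph V → Prop
  | triangle {V : Type u} (G : SimpleGraph V)
      (e : G ≃g (⊤ : SimpleGraph (Fin 3))) : IsGeneralisedTriangle G
  | subdivide {V W : Type u} (G : SimpleGraph V) (G' : SimpleGraph W) (p q : V)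
      (hG : IsGeneralisedTriangle G) (hpq : G.Adj p q)
      (e : G' ≃g doubleSubdivision G p q) : IsGeneralisedTriangle G'

/-- A set of vertices is a cut-set if its removal increases the number of components. -/
def IsCutSet {V : Type u} (G : SimpleGraph V) (S : Set V) : Prop :=
  ENat.card G.ConnectedComponent < ENat.card (G.induce Sᶜ).ConnectedComponent

/-- `{x, y}` is a 2-cut of `G`. -/
def IsTwoCut {V : Type u} (G : SimpleGraph V) (x y : V) : Prop :=
  x ≠ y ∧ IsCutSet G {x, y}

/-- `B` is an `{x, y}`-bridge of `G`: the subgraph induced on `V(C) ∪ {x, y}` for some connected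
component `C` of `G - {x, y}`. -/
def IsBridge {V : Type u} (G : SimpleGraph V) (x y : V) (B : G.Subgraph) : Prop :=
  ∃ C : (G.induce ({x, y}ᶜ : Set V)).ConnectedComponent,
    B = (⊤ : G.Subgraph).induce (Subtype.val '' C.supp ∪ {x, y})

/-- Property `P₂` of a 2-cut `{x, y}`: at least one `{x, y}`-bridge is trivial, i.e. has exactly
three vertices. -/
def HasP2 {V : Type u} (G : SimpleGraph V) (x y : V) : Prop :=
  ∃ B : G.Subgraph, IsBridge G x y B ∧ B.verts.ncard = 3

/-- The family `𝒦₂` of generalised triangles with property `P₂` at every 2-cut. -/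
def InK2 {V : Type u} (G : SimpleGraph V) : Prop :=
  IsGeneralisedTriangle G ∧ ∀ x y : V, IsTwoCut G x y → HasP2 G x y

/-- `H` is a minor of `G`: there are pairwise disjoint, connected (in particular non-empty) branch
sets in `G`, one for each vertex of `H`, with an edge of `G` between the branch sets of any two
adjacent vertices of `H`. -/
def IsMinor {W : Type v} {V : Type u} (H : SimpleGraph W) (G : SimpleGraph V) : Prop :=
  ∃ B : W → Set V,
    (∀ a, (G.induce (B a)).Connected) ∧
    (∀ a b, a ≠ b → Disjoint (B a) (B b)) ∧
    (∀ a b, H.Adj a b → ∃ s ∈ B a, ∃ t ∈ B b, G.Adj s t)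

/-- `K₂,₃`, with parts `{x, y}` (`x = inl 0`, `y = inl 1`) and `{u, v, w}`
(`u = inr 0`, `v = inr 1`, `w = inr 2`). -/
abbrev K23 : SimpleGraph (Fin 2 ⊕ Fin 3) := completeBipartiteGraph (Fin 2) (Fin 3)

/-- An old vertex of `K₂,₃` after one double subdivision. -/
abbrev old1 (a : Fin 2 ⊕ Fin 3) : (Fin 2 ⊕ Fin 3) ⊕ Fin 2 := Sum.inl a

/-- An old vertex of `K₂,₃` after two double subdivisions. -/
abbrev old2 (a : Fin 2 ⊕ Fin 3) : ((Fin 2 ⊕ Fin 3) ⊕ Fin 2) ⊕ Fin 2 := Sum.inl (old1 a)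

/-- `H₁`: `K₂,₃` with the edges `xu`, `xv` and `xw` doubly subdivided. -/
def H1 : SimpleGraph ((((Fin 2 ⊕ Fin 3) ⊕ Fin 2) ⊕ Fin 2) ⊕ Fin 2) :=
  doubleSubdivision
    (doubleSubdivision
      (doubleSubdivision K23 (Sum.inl 0) (Sum.inr 0))
      (old1 (Sum.inl 0)) (old1 (Sum.inr 1)))
    (old2 (Sum.inl 0)) (old2 (Sum.inr 2))

/-- `H₂`: `K₂,₃` with the edges `xu`, `xv` and `yw` doubly subdivided. -/
def H2 : SimpleGraph ((((Fin 2 ⊕ Fin 3) ⊕ Fin 2) ⊕ Fin 2) ⊕ Fin 2) :=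
  doubleSubdivision
    (doubleSubdivision
      (doubleSubdivision K23 (Sum.inl 0) (Sum.inr 0))
      (old1 (Sum.inl 0)) (old1 (Sum.inr 1)))
    (old2 (Sum.inl 1)) (old2 (Sum.inr 2))

end GenTriangle

/-! Two facts about generalised triangles, each proved by induction over double subdivisions, carry
the proof.

`IsSplittable`: deleting two vertices either leaves a connected graph or, for some non-adjacent
pairs, exactly three components (`Split`). Each component is a single vertex or contains a model of
a path between the two cut vertices with one of its two edges doubled (`Rooted`). If a 2-cut has no
trivial bridge, all three components carry such a model. Either the three doubled edges meet the
same cut vertex, which gives `H1`, or they divide two to one, which gives `H2` (`Split.isMinor`).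

`SplitsThreeEdges`: three distinct edges between disjoint connected sets `X` and `Y` are separated
from each other by a 2-cut with one vertex in each set. Both `H1` and `H2` contain three paths of
length three with common ends. In a model of this graph the three middle edges run between two
disjoint connected sets. The cut separating them must lie in the branch sets of the common ends, so
each component contains both ends of a middle edge and no bridge is trivial
(`ThetaModel.exists_split`). -/

namespace GenTriangle

universe u v
variable {V : Type u} {V' : Type v} {G : SimpleGraph V} {G' : SimpleGraph V'}

/-! ### Connected sets and contacts between them. -/

/-- `S` is connected in `G` (or empty): a property that spreads along the edges inside `S` and
holds somewhere in `S` holds everywhere in `S`. -/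
def ConnOn (G : SimpleGraph V) (S : Set V) : Prop :=
  ∀ P : V → Prop, (∀ v ∈ S, ∀ w ∈ S, G.Adj v w → P v → P w) → ∀ v ∈ S, ∀ w ∈ S, P v → P w

/-- There is an edge of `G` from `S` to `T`. -/
def Touch (G : SimpleGraph V) (S T : Set V) : Prop :=
  ∃ s ∈ S, ∃ t ∈ T, G.Adj s t

lemma Touch.symm {S T : Set V} (h : Touch G S T) : Touch G T S := by
  obtain ⟨s, hs, t, ht, h⟩ := h
  exact ⟨t, ht, s, hs, h.symm⟩

lemma Touch.mono {S T S' T' : Set V} (h : Touch G S T) (hS : S ⊆ S') (hT : T ⊆ T') :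
    Touch G S' T' := by
  obtain ⟨s, hs, t, ht, h⟩ := h
  exact ⟨s, hS hs, t, hT ht, h⟩

lemma Touch.nonempty_right {S T : Set V} (h : Touch G S T) : T.Nonempty := by
  obtain ⟨s, hs, t, ht, h⟩ := h
  exact ⟨t, ht⟩

lemma connOn_singleton (v : V) : ConnOn G {v} := by
  rintro P - a rfl b rfl h
  exact h

lemma ConnOn.of_connected {S : Set V} (h : (G.induce S).Preconnected) : ConnOn G S := by
  intro P hP v hv w hw hv'
  obtain ⟨p⟩ := h ⟨v, hv⟩ ⟨w, hw⟩
  have key : ∀ {a b : S}, (G.induce S).Walk a b → P a → P b := by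
    intro a b p
    induction p with
    | nil => exact id
    | cons hab _ ih => exact fun ha => ih (hP _ (Subtype.prop _) _ (Subtype.prop _) hab ha)
  exact key p hv'

lemma ConnOn.preconnected {S : Set V} (h : ConnOn G S) : (G.induce S).Preconnected := by
  rintro ⟨v, hv⟩ ⟨w, hw⟩
  obtain ⟨_, h⟩ := h (fun x => ∃ hx : x ∈ S, (G.induce S).Reachable ⟨v, hv⟩ ⟨x, hx⟩)
    (fun a ha b hb hab ⟨_, hr⟩ => ⟨hb, hr.trans (SimpleGraph.Adj.reachable hab)⟩) v hv w hw
    ⟨hv, SimpleGraph.Reachable.refl _⟩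
  exact h

lemma ConnOn.connected {S : Set V} (h : ConnOn G S) (hS : S.Nonempty) :
    (G.induce S).Connected :=
  have := hS.to_subtype
  ⟨h.preconnected⟩

lemma ConnOn.union {S T : Set V} (hS : ConnOn G S) (hT : ConnOn G T) (h : Touch G S T) :
    ConnOn G (S ∪ T) := by
  obtain ⟨s, hs, t, ht, hst⟩ := h
  intro P hP
  have hS' := hS P fun v hv w hw => hP v (.inl hv) w (.inl hw)
  have hT' := hT P fun v hv w hw => hP v (.inr hv) w (.inr hw)
  have h1 := hP s (.inl hs) t (.inr ht) hst
  have h2 := hP t (.inr ht) s (.inl hs) hst.symm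
  rintro v (hv | hv) w (hw | hw) hPv
  · exact hS' v hv w hw hPv
  · exact hT' t ht w hw (h1 (hS' v hv s hs hPv))
  · exact hS' s hs w hw (h2 (hT' v hv t ht hPv))
  · exact hT' v hv w hw hPv

lemma ConnOn.union_biUnion {ι : Type*} {S : Set V} {A : ι → Set V} (I : Set ι) (hS : ConnOn G S)
    (hA : ∀ i, ConnOn G (A i)) (h : ∀ i, Touch G S (A i)) :
    ConnOn G (S ∪ ⋃ i ∈ I, A i) := by
  rcases isEmpty_or_nonempty ι with _ | ⟨⟨i₀⟩⟩
  · simpa [Set.eq_empty_of_isEmpty I] using hS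
  obtain ⟨s, hs, -⟩ := h i₀
  have sub : ∀ i ∈ I, S ∪ A i ⊆ S ∪ ⋃ i ∈ I, A i := fun i hi =>
    Set.union_subset_union_right _ (Set.subset_biUnion_of_mem (u := A) hi)
  intro P hP
  have key : ∀ v ∈ S ∪ ⋃ i ∈ I, A i, P v ↔ P s := by
    rintro v (hv | hv)
    · have := hS P fun a ha b hb => hP a (.inl ha) b (.inl hb)
      exact ⟨this v hv s hs, this s hs v hv⟩
    · obtain ⟨i, hi, hv⟩ := Set.mem_iUnion₂.1 hv
      have := (hS.union (hA i) (h i)) P fun a ha b hb => hP a (sub i hi ha) b (sub i hi hb)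
      exact ⟨this v (.inr hv) s (.inl hs), this s (.inl hs) v (.inr hv)⟩
  intro v hv w hw hPv
  exact (key w hw).2 ((key v hv).1 hPv)

/-! ### Rooted models and the three components at a 2-cut. -/

/-- In `C` there are disjoint connected sets `A`, `B`, `U` which, together with `x` and `y`, form
a model of the path `x u y` with its edge `xu` doubly subdivided. -/
def Rooted (G : SimpleGraph V) (x y : V) (C : Set V) : Prop :=
  ∃ A B U : Set V, (A ⊆ C ∧ B ⊆ C ∧ U ⊆ C) ∧ (Disjoint A B ∧ Disjoint A U ∧ Disjoint B U) ∧
    (ConnOn G A ∧ ConnOn G B ∧ ConnOn G U) ∧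
    Touch G {x} A ∧ Touch G {x} B ∧ Touch G A U ∧ Touch G B U ∧ Touch G {y} U

/-- `C` is connected, has neighbours `s` and `t`, and is a single vertex or contains a model as in
`Rooted`. -/
def Good (G : SimpleGraph V) (s t : V) (C : Set V) : Prop :=
  ConnOn G C ∧ Touch G {s} C ∧ Touch G {t} C ∧
    ((∃ v, C = {v}) ∨ Rooted G s t C ∨ Rooted G t s C)

lemma Good.swap {s t : V} {C : Set V} (h : Good G s t C) : Good G t s C := by
  obtain ⟨h1, h2, h3, h4⟩ := h
  exact ⟨h1, h3, h2, h4.imp_right Or.symm⟩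

/-- The vertices of colour `i` other than `s` and `t`. -/
def cls (c : V → Fin 3) (s t : V) (i : Fin 3) : Set V := {v | v ≠ s ∧ v ≠ t ∧ c v = i}

/-- The colour classes of `c` are the three components of `G - {s, t}`. -/
structure Split (G : SimpleGraph V) (s t : V) (c : V → Fin 3) : Prop where
  ne : s ≠ t
  not_adj : ¬ G.Adj s t
  cross : ∀ v w, G.Adj v w → v ≠ s → v ≠ t → w ≠ s → w ≠ t → c v = c w
  good : ∀ i, Good G s t (cls c s t i)

lemma cls_swap (c : V → Fin 3) (s t : V) (i : Fin 3) : cls c t s i = cls c s t i := by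
  ext v
  simp only [cls, Set.mem_ofPred_eq]
  tauto

lemma Split.swap {s t : V} {c : V → Fin 3} (h : Split G s t c) : Split G t s c where
  ne := h.ne.symm
  not_adj := fun h' => h.not_adj h'.symm
  cross := fun v w hvw h1 h2 h3 h4 => h.cross v w hvw h2 h1 h4 h3
  good := fun i => by rw [cls_swap]; exact (h.good i).swap

/-- A set of vertices that avoids `s` and `t` and is connected lies in one class. -/
lemma Split.eq_of_connOn {s t : V} {c : V → Fin 3} (h : Split G s t c) {S : Set V}
    (hS : ConnOn G S) (hs : s ∉ S) (ht : t ∉ S) {v w : V} (hv : v ∈ S) (hw : w ∈ S) :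
    c v = c w := by
  have ns : ∀ x ∈ S, x ≠ s := fun x hx hxs => hs (hxs ▸ hx)
  have nt : ∀ x ∈ S, x ≠ t := fun x hx hxt => ht (hxt ▸ hx)
  exact hS (fun x => c v = c x) (fun a ha b hb hab e =>
    e.trans (h.cross a b hab (ns a ha) (nt a ha) (ns b hb) (nt b hb))) v hv w hw rfl

/-- Transport of `Rooted` along a map of sets of vertices. -/
lemma Rooted.map {x y : V} {x' y' : V'} {C : Set V} (F : Set V → Set V')
    (hmono : ∀ S, S ⊆ C → F S ⊆ F C)
    (hdisj : ∀ S T, Disjoint S T → Disjoint (F S) (F T))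
    (hconn : ∀ S, S ⊆ C → ConnOn G S → ConnOn G' (F S))
    (htouch : ∀ S T, S ⊆ C → T ⊆ C → Touch G S T → Touch G' (F S) (F T))
    (hx : ∀ T, T ⊆ C → Touch G {x} T → Touch G' {x'} (F T))
    (hy : ∀ T, T ⊆ C → Touch G {y} T → Touch G' {y'} (F T))
    (h : Rooted G x y C) : Rooted G' x' y' (F C) := by
  obtain ⟨A, B, U, ⟨hA, hB, hU⟩, ⟨d1, d2, d3⟩, ⟨c1, c2, c3⟩, t1, t2, t3, t4, t5⟩ := h
  exact ⟨F A, F B, F U, ⟨hmono _ hA, hmono _ hB, hmono _ hU⟩,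
    ⟨hdisj _ _ d1, hdisj _ _ d2, hdisj _ _ d3⟩,
    ⟨hconn _ hA c1, hconn _ hB c2, hconn _ hU c3⟩,
    hx _ hA t1, hx _ hB t2, htouch _ _ hA hU t3, htouch _ _ hB hU t4, hy _ hU t5⟩

/-- Transport of `Good` along a map of sets of vertices. -/
lemma Good.map {x y : V} {x' y' : V'} {C : Set V} (F : Set V → Set V')
    (hmono : ∀ S, S ⊆ C → F S ⊆ F C)
    (hdisj : ∀ S T, Disjoint S T → Disjoint (F S) (F T))
    (hconn : ∀ S, S ⊆ C → ConnOn G S → ConnOn G' (F S))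
    (htouch : ∀ S T, S ⊆ C → T ⊆ C → Touch G S T → Touch G' (F S) (F T))
    (hx : ∀ T, T ⊆ C → Touch G {x} T → Touch G' {x'} (F T))
    (hy : ∀ T, T ⊆ C → Touch G {y} T → Touch G' {y'} (F T))
    (hsingle : ∀ v, C = {v} → (∃ w, F C = {w}) ∨ Rooted G' x' y' (F C) ∨ Rooted G' y' x' (F C))
    (h : Good G x y C) : Good G' x' y' (F C) := by
  obtain ⟨h1, h2, h3, h4⟩ := h
  refine ⟨hconn _ subset_rfl h1, hx _ subset_rfl h2, hy _ subset_rfl h3, ?_⟩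
  rcases h4 with ⟨v, hv⟩ | h4 | h4
  · exact hsingle v hv
  · exact .inr (.inl (h4.map F hmono hdisj hconn htouch hx hy))
  · exact .inr (.inr (h4.map F hmono hdisj hconn htouch hy hx))

/-! ### Pulling structure back along contractions. -/

/-- `π` exhibits `G` as obtained from `G'` by contracting connected sets. -/
structure IsContraction (G' : SimpleGraph V') (G : SimpleGraph V) (π : V' → V) : Prop where
  fibre : ∀ v, ConnOn G' (π ⁻¹' {v})
  lift : ∀ v w, G.Adj v w → Touch G' (π ⁻¹' {v}) (π ⁻¹' {w})
  proj : ∀ v w, G'.Adj v w → π v = π w ∨ G.Adj (π v) (π w)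

lemma preimage_iso_singleton (e : G' ≃g G) (v : V) : (e : V' → V) ⁻¹' {v} = {e.symm v} := by
  ext w
  simp only [Set.mem_preimage, Set.mem_singleton_iff]
  exact ⟨fun h => by rw [← h]; simp, fun h => by rw [h]; simp⟩

lemma IsContraction.of_iso (e : G' ≃g G) : IsContraction G' G e where
  fibre v := by
    rw [preimage_iso_singleton]
    exact connOn_singleton _
  lift v w h := ⟨e.symm v, by simp, e.symm w, by simp, e.symm.map_adj_iff.2 h⟩
  proj v w h := .inr (e.map_adj_iff.2 h)

namespace IsContraction

variable {π : V' → V}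

lemma touch (hπ : IsContraction G' G π) {S T : Set V} (h : Touch G S T) :
    Touch G' (π ⁻¹' S) (π ⁻¹' T) := by
  obtain ⟨s, hs, t, ht, h⟩ := h
  exact (hπ.lift s t h).mono (Set.preimage_mono (by simpa using hs))
    (Set.preimage_mono (by simpa using ht))

lemma connOn (hπ : IsContraction G' G π) {S : Set V} (h : ConnOn G S) :
    ConnOn G' (π ⁻¹' S) := by
  intro P hP v hv w hw hPv
  have fib : ∀ x ∈ S, ∀ a, π a = x → ∀ b, π b = x → P a → P b := by
    intro x hx a ha b hb
    refine hπ.fibre x P (fun c hc d hd => hP c ?_ d ?_) a ha b hb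
    · rw [Set.mem_preimage, show π c = x from hc]; exact hx
    · rw [Set.mem_preimage, show π d = x from hd]; exact hx
  -- The property spread in `G` is that some point of the fibre satisfies `P`. By `fib` it then
  -- holds on the whole fibre, in particular at the end of the lifted edge.
  obtain ⟨b, hb, hPb⟩ := h (fun x => ∃ a, π a = x ∧ P a) (by
    rintro x hx y hy hxy ⟨a, ha, hPa⟩
    obtain ⟨a', ha', b', hb', hab⟩ := hπ.lift x y hxy
    refine ⟨b', hb', hP a' ?_ b' ?_ hab (fib x hx a ha a' ha' hPa)⟩
    · rw [Set.mem_preimage, show π a' = x from ha']; exact hx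
    · rw [Set.mem_preimage, show π b' = y from hb']; exact hy) (π v) hv (π w) hw ⟨v, rfl, hPv⟩
  exact fib _ hw b hb w rfl hPb

/-- Connectivity, contacts and rooted models all pull back. Only triviality can be lost, when the
fibre of the single vertex is larger; `hsingle` covers that case. -/
lemma good (hπ : IsContraction G' G π) {s t : V} {s' t' : V'} {C : Set V}
    (hs : π ⁻¹' {s} = {s'}) (ht : π ⁻¹' {t} = {t'})
    (hsingle : ∀ v, C = {v} → (∃ w, π ⁻¹' C = {w}) ∨ Rooted G' s' t' (π ⁻¹' C) ∨
      Rooted G' t' s' (π ⁻¹' C))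
    (h : Good G s t C) : Good G' s' t' (π ⁻¹' C) :=
  h.map (fun S => π ⁻¹' S) (fun _ h => Set.preimage_mono h)
    (fun _ _ h => h.preimage π) (fun _ _ => hπ.connOn) (fun _ _ _ _ => hπ.touch)
    (fun _ _ h => hs ▸ hπ.touch h) (fun _ _ h => ht ▸ hπ.touch h) hsingle

lemma split (hπ : IsContraction G' G π) {s t : V} {s' t' : V'} {c : V → Fin 3}
    (hs : π ⁻¹' {s} = {s'}) (ht : π ⁻¹' {t} = {t'})
    (hsingle : ∀ i v, cls c s t i = {v} → (∃ w, π ⁻¹' (cls c s t i) = {w}) ∨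
      Rooted G' s' t' (π ⁻¹' (cls c s t i)) ∨ Rooted G' t' s' (π ⁻¹' (cls c s t i)))
    (h : Split G s t c) : Split G' s' t' (c ∘ π) := by
  have hs' : ∀ v, π v = s ↔ v = s' := fun v => by
    simpa using Set.ext_iff.1 hs v
  have ht' : ∀ v, π v = t ↔ v = t' := fun v => by
    simpa using Set.ext_iff.1 ht v
  have h1 := (hs' s').2 rfl
  have h2 := (ht' t').2 rfl
  refine ⟨fun h' => h.ne (by rw [← h1, ← h2, h']), fun h' => ?_, fun v w hvw a1 a2 a3 a4 => ?_,
    fun i => ?_⟩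
  · rcases hπ.proj _ _ h' with h' | h'
    · exact h.ne (by rw [← h1, ← h2, h'])
    · exact h.not_adj (by rwa [h1, h2] at h')
  · rcases hπ.proj _ _ hvw with h' | h'
    · simp [h']
    · exact h.cross _ _ h' (mt (hs' v).1 a1) (mt (ht' v).1 a2) (mt (hs' w).1 a3) (mt (ht' w).1 a4)
  · have : cls (c ∘ π) s' t' i = π ⁻¹' (cls c s t i) := by
      ext v
      simp [cls, hs', ht']
    rw [this]
    exact hπ.good hs ht (hsingle i) (h.good i)

end IsContraction

end GenTriangle

namespace GenTriangle

universe u v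
variable {V : Type u} {V' : Type v} {G : SimpleGraph V} {G' : SimpleGraph V'} {p q : V}

open Sum

/-! ### Double subdivision and its effect on components. -/

@[simp] lemma doubleSubdivision_inl_inl (a b : V) :
    (doubleSubdivision G p q).Adj (inl a) (inl b) ↔ G.Adj a b ∧ s(a, b) ≠ s(p, q) := by
  change (G.deleteEdges {s(p, q)}).Adj a b ↔ _
  simp [SimpleGraph.deleteEdges_adj]

@[simp] lemma doubleSubdivision_inl_inr (a : V) (k : Fin 2) :
    (doubleSubdivision G p q).Adj (inl a) (inr k) ↔ a = p ∨ a = q := Iff.rfl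

@[simp] lemma doubleSubdivision_inr_inl (a : V) (k : Fin 2) :
    (doubleSubdivision G p q).Adj (inr k) (inl a) ↔ a = p ∨ a = q := Iff.rfl

@[simp] lemma doubleSubdivision_inr_inr (k l : Fin 2) :
    ¬ (doubleSubdivision G p q).Adj (inr k) (inr l) := id

lemma doubleSubdivision_comm (G : SimpleGraph V) (p q : V) :
    doubleSubdivision G p q = doubleSubdivision G q p := by
  ext (a | k) (b | l)
  · simp [Sym2.eq_swap (a := p)]
  · simp [or_comm]
  · simp [or_comm]
  · simp

/-- Both new vertices go to `p`, so every other fibre, that of `q` included, is a single vertex. To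
keep two given vertices `s`, `t` uncontracted, one uses an end of the edge that avoids both,
exchanging `p` and `q` by `doubleSubdivision_comm` if needed. -/
lemma doubleSubdivision_isContraction (h : G.Adj p q) :
    IsContraction (doubleSubdivision G p q) G (Sum.elim id fun _ => p) where
  fibre v := by
    intro P hP
    have key : ∀ x : V ⊕ Fin 2, x ∈ (Sum.elim id fun _ => p : V ⊕ Fin 2 → V) ⁻¹' {v} →
        (P x ↔ P (inl v)) := by
      rintro (w | k) hx
      · obtain rfl : w = v := hx
        rfl
      · obtain rfl : p = v := hx
        exact ⟨hP _ rfl (inl p) rfl (by simp), hP (inl p) rfl _ rfl (by simp)⟩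
    intro a ha b hb hPa
    exact (key b hb).2 ((key a ha).1 hPa)
  lift v w hvw := by
    by_cases he : s(v, w) = s(p, q)
    · rcases Sym2.eq_iff.1 he with ⟨rfl, rfl⟩ | ⟨rfl, rfl⟩
      · exact ⟨inr 0, by simp, inl w, by simp, by simp⟩
      · exact ⟨inl v, by simp, inr 0, by simp, by simp⟩
    · exact ⟨inl v, by simp, inl w, by simp, by simp [hvw, he]⟩
  proj := by
    rintro (a | k) (b | l) hab
    · simp only [doubleSubdivision_inl_inl] at hab
      exact .inr hab.1
    · rcases hab with rfl | rfl
      · simp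
      · exact .inr h.symm
    · rcases hab with rfl | rfl
      · simp
      · exact .inr h
    · exact (doubleSubdivision_inr_inr k l hab).elim

lemma preimage_contraction_of_notMem {S : Set V} (hp : p ∉ S) :
    (Sum.elim id fun _ => p : V ⊕ Fin 2 → V) ⁻¹' S = inl '' S := by
  ext (v | k) <;> simp [hp]

/-- The model witnessing `Rooted` once the edge joining a trivial bridge to `s` is doubly
subdivided. -/
lemma rooted_of_trivial {s t : V} (hpt : G.Adj p t) (hst : s ≠ t) {C : Set (V ⊕ Fin 2)}
    (hC : C = {inl p, inr 0, inr 1}) :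
    Rooted (doubleSubdivision G p s) (inl s) (inl t) C := by
  subst hC
  refine ⟨{inr 0}, {inr 1}, {inl p}, ⟨by simp, by simp, by simp⟩, ⟨by simp, by simp, by simp⟩,
    ⟨connOn_singleton _, connOn_singleton _, connOn_singleton _⟩, ?_⟩
  simp [Touch, hpt.symm, hst.symm, hpt.ne']

lemma Good.trivial_adj {s t v : V} (h : Good G s t {v}) : G.Adj s v ∧ G.Adj t v := by
  obtain ⟨-, ⟨a, rfl, b, rfl, h1⟩, ⟨c, rfl, d, rfl, h2⟩, -⟩ := h
  exact ⟨h1, h2⟩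

lemma preimage_contraction_singleton :
    (Sum.elim id fun _ => p : V ⊕ Fin 2 → V) ⁻¹' {p} = {inl p, inr 0, inr 1} := by
  ext (v | k)
  · simp
  · fin_cases k <;> simp

/-- What is needed to transport a trivial bridge to the double subdivision. -/
lemma trivial_or_rooted {s t : V} {C : Set V} (hpq : G.Adj p q) (hst : s ≠ t)
    (hC : ∀ v ∈ C, ∀ w, G.Adj v w → w ∈ C ∨ w = s ∨ w = t) (hg : Good G s t C)
    (v : V) (hv : C = {v}) :
    (∃ w, (Sum.elim id fun _ => p : V ⊕ Fin 2 → V) ⁻¹' C = {w}) ∨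
      Rooted (doubleSubdivision G p q) (inl s) (inl t) ((Sum.elim id fun _ => p) ⁻¹' C) ∨
      Rooted (doubleSubdivision G p q) (inl t) (inl s) ((Sum.elim id fun _ => p) ⁻¹' C) := by
  subst hv
  have h := hg.trivial_adj
  by_cases hp : v = p
  · subst hp
    right
    rw [preimage_contraction_singleton]
    rcases hC v rfl q hpq with h' | rfl | rfl
    · exact (hpq.ne' h').elim
    · exact .inl (rooted_of_trivial h.2.symm hst rfl)
    · exact .inr (rooted_of_trivial h.1.symm hst.symm rfl)
  · left
    exact ⟨inl v, by rw [preimage_contraction_of_notMem (by simpa using Ne.symm hp)]; simp⟩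

lemma Good.doubleSubdivision {s t : V} {C : Set V} (hpq : G.Adj p q) (hst : s ≠ t)
    (hs : p ≠ s) (ht : p ≠ t)
    (hC : ∀ v ∈ C, ∀ w, G.Adj v w → w ∈ C ∨ w = s ∨ w = t) (hg : Good G s t C) :
    Good (doubleSubdivision G p q) (inl s) (inl t) ((Sum.elim id fun _ => p) ⁻¹' C) :=
  (doubleSubdivision_isContraction hpq).good
    (by rw [preimage_contraction_of_notMem (by simpa using hs)]; simp)
    (by rw [preimage_contraction_of_notMem (by simpa using ht)]; simp)
    (trivial_or_rooted hpq hst hC hg) hg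

lemma Split.closed {s t : V} {c : V → Fin 3} (h : Split G s t c) (i : Fin 3) :
    ∀ v ∈ cls c s t i, ∀ w, G.Adj v w → w ∈ cls c s t i ∨ w = s ∨ w = t := by
  rintro v ⟨h1, h2, h3⟩ w hvw
  by_cases hs : w = s
  · exact .inr (.inl hs)
  by_cases ht : w = t
  · exact .inr (.inr ht)
  exact .inl ⟨hs, ht, by rw [← h.cross v w hvw h1 h2 hs ht, h3]⟩

lemma Split.doubleSubdivision_left {s t : V} {c : V → Fin 3} (hpq : G.Adj p q) (h : Split G s t c)
    (hs : p ≠ s) (ht : p ≠ t) :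
    Split (doubleSubdivision G p q) (inl s) (inl t) (c ∘ Sum.elim id fun _ => p) :=
  (doubleSubdivision_isContraction hpq).split
    (by rw [preimage_contraction_of_notMem (by simpa using hs)]; simp)
    (by rw [preimage_contraction_of_notMem (by simpa using ht)]; simp)
    (fun i => trivial_or_rooted hpq h.ne (h.closed i) (h.good i)) h

/-- The components of `G - {s, t}` persist when an edge `pq` of `G` is doubly subdivided. -/
lemma Split.doubleSubdivision {s t : V} {c : V → Fin 3} (hpq : G.Adj p q) (h : Split G s t c) :
    ∃ c', Split (doubleSubdivision G p q) (inl s) (inl t) c' ∧ (∀ v, c' (inl v) = c v) ∧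
      ∀ k v, (v = p ∨ v = q) → v ≠ s → v ≠ t → c' (inr k) = c v := by
  by_cases hp : p ≠ s ∧ p ≠ t
  · refine ⟨_, h.doubleSubdivision_left hpq hp.1 hp.2, fun v => rfl, ?_⟩
    rintro k v (rfl | rfl) hs ht
    · rfl
    · exact h.cross _ _ hpq hp.1 hp.2 hs ht
  -- Here `p` is one of `s`, `t`; these are not adjacent, so `q` is neither.
  · have hq : q ≠ s ∧ q ≠ t := by
      constructor
      · rintro rfl
        exact hp ⟨hpq.ne, fun e => h.not_adj (e ▸ hpq.symm)⟩
      · rintro rfl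
        exact hp ⟨fun e => h.not_adj (e ▸ hpq), hpq.ne⟩
    rw [doubleSubdivision_comm]
    refine ⟨_, h.doubleSubdivision_left hpq.symm hq.1 hq.2, fun v => rfl, ?_⟩
    rintro k v (rfl | rfl) hs ht
    · exact (hp ⟨hs, ht⟩).elim
    · rfl

lemma Touch.inl_image {S T : Set V} (h : Touch G S T) (hp : p ∉ T) (hq : q ∉ T) :
    Touch (doubleSubdivision G p q) (inl '' S) (inl '' T) := by
  obtain ⟨s, hs, t, ht, h⟩ := h
  refine ⟨inl s, ⟨s, hs, rfl⟩, inl t, ⟨t, ht, rfl⟩, ?_⟩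
  rw [doubleSubdivision_inl_inl]
  refine ⟨h, fun e => ?_⟩
  rcases Sym2.eq_iff.1 e with ⟨rfl, rfl⟩ | ⟨rfl, rfl⟩
  · exact hq ht
  · exact hp ht

lemma ConnOn.inl_image {S : Set V} (hpq : G.Adj p q) (h : ConnOn G S) (hp : p ∉ S) :
    ConnOn (GenTriangle.doubleSubdivision G p q) (inl '' S) := by
  rw [← preimage_contraction_of_notMem hp]
  exact (doubleSubdivision_isContraction hpq).connOn h

/-- The component of `G - {p, q}` persists when `pq` is doubly subdivided. -/
lemma Good.inl_image (hpq : G.Adj p q) (h : Good G p q {p, q}ᶜ) :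
    Good (GenTriangle.doubleSubdivision G p q) (inl p) (inl q) (inl '' ({p, q}ᶜ : Set V)) := by
  have hp : ∀ S : Set V, S ⊆ {p, q}ᶜ → p ∉ S := fun S hS hpS => hS hpS (by simp)
  have hq : ∀ S : Set V, S ⊆ {p, q}ᶜ → q ∉ S := fun S hS hqS => hS hqS (by simp)
  refine h.map (fun S => inl '' S) (fun _ h => Set.image_mono h)
    (fun _ _ h => (Set.disjoint_image_iff inl_injective).2 h)
    (fun S hS h => h.inl_image hpq (hp S hS)) (fun S T _ hT h => h.inl_image (hp T hT) (hq T hT))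
    (fun T hT h => ?_) (fun T hT h => ?_) ?_
  · simpa using h.inl_image (hp T hT) (hq T hT)
  · simpa using h.inl_image (hp T hT) (hq T hT)
  · intro v hv
    exact .inl ⟨inl v, by rw [hv]; simp⟩

/-- The components of the double subdivision at `pq` without `p` and `q`. -/
lemma Good.split (hpq : G.Adj p q) (h : Good G p q {p, q}ᶜ) (c : V ⊕ Fin 2 → Fin 3) (m : Fin 3)
    (hm : ∀ v, c (inl v) = m) (hinj : ∀ k l, c (inr k) = c (inr l) → k = l)
    (hne : ∀ k, c (inr k) ≠ m) :
    Split (GenTriangle.doubleSubdivision G p q) (inl p) (inl q) c where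
  ne := by simpa using hpq.ne
  not_adj := by simp
  cross := by
    rintro (v | k) (w | l) hvw h1 h2 h3 h4
    · rw [hm, hm]
    · rcases hvw with rfl | rfl <;> contradiction
    · rcases hvw with rfl | rfl <;> contradiction
    · exact (doubleSubdivision_inr_inr _ _ hvw).elim
  good i := by
    by_cases hi : i = m
    · subst hi
      convert h.inl_image hpq using 1
      ext (v | k)
      · simp [cls, hm]
      · simp [cls, hne]
    -- The new vertices take two distinct colours other than `m`, hence all the remaining ones.
    · obtain ⟨k, hk⟩ : ∃ k, c (inr k) = i := by
        have h01 : c (inr 0) ≠ c (inr 1) := fun e => by simpa using hinj _ _ e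
        have h0 := hne 0
        have h1 := hne 1
        by_cases e : c (inr 0) = i
        · exact ⟨0, e⟩
        · exact ⟨1, by omega⟩
      have : cls c (inl p) (inl q) i = {inr k} := by
        ext (v | l)
        · simp [cls, hm, Ne.symm hi]
        · simp only [cls, Set.mem_ofPred_eq, Set.mem_singleton_iff, inr.injEq]
          exact ⟨fun h => hinj _ _ (h.2.2.trans hk.symm), fun h => ⟨by simp, by simp, h ▸ hk⟩⟩
      rw [this]
      exact ⟨connOn_singleton _, ⟨inl p, rfl, inr k, rfl, by simp⟩,
        ⟨inl q, rfl, inr k, rfl, by simp⟩, .inl ⟨_, rfl⟩⟩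

/-- A connected set that contains the doubly subdivided edge remains connected if one of the two
new vertices is added. -/
lemma ConnOn.inl_image_union {S : Set V} (h : ConnOn G S) (hp : p ∈ S) (k : Fin 2) :
    ConnOn (GenTriangle.doubleSubdivision G p q) (inl '' S ∪ {inr k}) := by
  intro P hP
  have memS : ∀ v ∈ S, inl v ∈ (inl '' S ∪ {inr k} : Set (V ⊕ Fin 2)) :=
    fun v hv => .inl ⟨v, hv, rfl⟩
  have memk : inr k ∈ (inl '' S ∪ {inr k} : Set (V ⊕ Fin 2)) := .inr rfl
  have hS := h (fun v => P (inl v)) (by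
    intro v hv w hw hvw hPv
    -- The deleted edge is replaced by the path through the new vertex `k`.
    by_cases he : s(v, w) = s(p, q)
    · have hv' : v = p ∨ v = q := by
        rcases Sym2.eq_iff.1 he with e | e <;> simp [e]
      have hw' : w = p ∨ w = q := by
        rcases Sym2.eq_iff.1 he with e | e <;> simp [e]
      exact hP _ memk _ (memS w hw) hw' (hP _ (memS v hv) _ memk hv' hPv)
    · exact hP _ (memS v hv) _ (memS w hw)
        ((doubleSubdivision_inl_inl v w).2 ⟨hvw, he⟩) hPv)
  have key : ∀ x ∈ (inl '' S ∪ {inr k} : Set (V ⊕ Fin 2)), P x ↔ P (inl p) := by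
    rintro _ (⟨v, hv, rfl⟩ | rfl)
    · exact ⟨hS v hv p hp, hS p hp v hv⟩
    · exact ⟨hP _ memk _ (memS p hp) (.inl rfl), hP _ (memS p hp) _ memk (.inl rfl)⟩
  intro v hv w hw hPv
  exact (key w hw).2 ((key v hv).1 hPv)

/-! ### Two-vertex deletions in generalised triangles. -/

/-- The connectivity properties that pass from a graph to its double subdivisions. -/
structure IsSplittable (G : SimpleGraph V) : Prop where
  conn : ConnOn G Set.univ
  conn_one : ∀ s, ConnOn G {s}ᶜ
  edge : ∀ s t, G.Adj s t → Good G s t {s, t}ᶜ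
  pair : ∀ s t, s ≠ t → ¬ G.Adj s t → ConnOn G {s, t}ᶜ ∨ ∃ c, Split G s t c

/-- If only one new vertex is deleted, the other still links `p` to `q`, and `G - s` is connected.
If both are deleted, what remains is `G` without the edge `pq`, where `p` and `q` are joined through
the connected rest. -/
lemma IsSplittable.conn_delete_new (hG : IsSplittable G) (hpq : G.Adj p q) (s : V ⊕ Fin 2)
    (k : Fin 2) : ConnOn (doubleSubdivision G p q) {s, inr k}ᶜ ∨
      (doubleSubdivision G p q).Adj s (inr k) ∨ s = inr k := by
  rcases s with s | l
  · by_cases h : s = p ∨ s = q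
    · exact .inr (.inl h)
    rw [not_or] at h
    left
    have : ({inl s, inr k}ᶜ : Set (V ⊕ Fin 2)) = inl '' {s}ᶜ ∪ {inr (1 - k)} := by
      ext (v | l)
      · simp
      · simp only [Set.mem_compl_iff, Set.mem_insert_iff, Set.mem_singleton_iff, Set.mem_union]
        simp; omega
    rw [this]
    exact (hG.conn_one s).inl_image_union (by simpa using Ne.symm h.1) _
  · by_cases h : l = k
    · simp [h]
    left
    have : ({inr l, inr k}ᶜ : Set (V ⊕ Fin 2)) =
        {inl p} ∪ ({inl q} ∪ inl '' ({p, q}ᶜ : Set V)) := by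
      ext (v | j)
      · simp; tauto
      · simp; omega
    obtain ⟨h1, h2, h3, -⟩ := (hG.edge p q hpq).inl_image hpq
    rw [this]
    exact (connOn_singleton _).union ((connOn_singleton _).union h1 h3)
      (h2.mono subset_rfl Set.subset_union_right)

lemma IsSplittable.edge_new (hG : IsSplittable G) (hpq : G.Adj p q) (k : Fin 2) :
    Good (doubleSubdivision G p q) (inl p) (inr k) {inl p, inr k}ᶜ := by
  have hC : ({inl p, inr k}ᶜ : Set (V ⊕ Fin 2)) =
      {inr (1 - k)} ∪ ({inl q} ∪ inl '' ({p, q}ᶜ : Set V)) := by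
    have := hpq.ne'
    ext (v | l)
    · simp only [Set.mem_compl_iff, Set.mem_insert_iff, Set.mem_singleton_iff, Set.mem_union]
      simp
      by_cases hv : v = q
      · simp [hv, this]
      · simp [hv]
    · simp; omega
  obtain ⟨h1, h2, h3, -⟩ := (hG.edge p q hpq).inl_image hpq
  rw [hC]
  refine ⟨(connOn_singleton _).union ((connOn_singleton _).union h1 h3)
    ⟨inr (1 - k), rfl, inl q, .inl rfl, by simp⟩, ⟨inl p, rfl, inr (1 - k), .inl rfl, by simp⟩,
    ⟨inr k, rfl, inl q, .inr (.inl rfl), by simp⟩, .inr (.inl ?_)⟩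
  -- Two disjoint routes lead from `p` to `q`, one through the other new vertex and one through the
  -- rest of `G`. The vertex `q` is a neighbour of the second root `inr k`.
  refine ⟨{inr (1 - k)}, inl '' {p, q}ᶜ, {inl q}, ⟨Set.subset_union_left,
    Set.subset_union_right.trans Set.subset_union_right,
    Set.subset_union_left.trans Set.subset_union_right⟩, ⟨by simp, by simp, by simp⟩,
    ⟨connOn_singleton _, h1, connOn_singleton _⟩, ?_, h2, ?_, h3.symm, ?_⟩
  · exact ⟨inl p, rfl, inr (1 - k), rfl, by simp⟩
  · exact ⟨inr (1 - k), rfl, inl q, rfl, by simp⟩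
  · exact ⟨inr k, rfl, inl q, rfl, by simp⟩

lemma IsSplittable.edge_old (hG : IsSplittable G) (hpq : G.Adj p q) {s t : V} (hst : G.Adj s t)
    (hs : p ≠ s) (ht : p ≠ t) :
    Good (doubleSubdivision G p q) (inl s) (inl t) {inl s, inl t}ᶜ := by
  convert (hG.edge s t hst).doubleSubdivision hpq hst.ne hs ht (fun v _ w _ => ?_) using 1
  · ext (v | k)
    · simp
    · simp [hs, ht]
  · simp; tauto

/-- The only old pair that loses its adjacency is `p`, `q`. Its deletion leaves three components:
the two new vertices and the rest of `G`. Any other split of an old pair is inherited from `G`. -/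
lemma IsSplittable.doubleSubdivision (hG : IsSplittable G) (hpq : G.Adj p q) :
    IsSplittable (GenTriangle.doubleSubdivision G p q) where
  conn := (doubleSubdivision_isContraction hpq).connOn hG.conn
  conn_one := by
    rintro (s | k)
    · have key : ∀ {p q : V}, G.Adj p q → p ≠ s →
          ConnOn (GenTriangle.doubleSubdivision G p q) {inl s}ᶜ := by
        intro p q hpq hp
        convert (doubleSubdivision_isContraction hpq).connOn (hG.conn_one s) using 1
        ext (v | k)
        · simp
        · simp [hp]
      by_cases hp : p = s
      · rw [doubleSubdivision_comm]
        exact key hpq.symm (hp ▸ hpq.ne')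
      · exact key hpq hp
    · convert hG.conn.inl_image_union (Set.mem_univ p) (1 - k) using 1
      ext (v | l)
      · simp
      · simp; omega
  edge := by
    have new : ∀ s k, (GenTriangle.doubleSubdivision G p q).Adj (inl s) (inr k) →
        Good (GenTriangle.doubleSubdivision G p q) (inl s) (inr k) {inl s, inr k}ᶜ := by
      rintro s k (rfl | rfl)
      · exact hG.edge_new hpq k
      · rw [doubleSubdivision_comm]
        exact hG.edge_new hpq.symm k
    rintro (s | k) (t | l) hst
    · rw [doubleSubdivision_inl_inl] at hst
      by_cases hp : p ≠ s ∧ p ≠ t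
      · exact hG.edge_old hpq hst.1 hp.1 hp.2
      · have hq : q ≠ s ∧ q ≠ t := by
          constructor
          · rintro rfl
            exact hp ⟨hpq.ne, by rintro rfl; exact hst.2 (Sym2.eq_swap)⟩
          · rintro rfl
            exact hp ⟨by rintro rfl; exact hst.2 rfl, hpq.ne⟩
        rw [doubleSubdivision_comm]
        exact hG.edge_old hpq.symm hst.1 hq.1 hq.2
    · exact new s l hst
    · rw [Set.pair_comm]
      exact (new t k hst.symm).swap
    · exact (doubleSubdivision_inr_inr _ _ hst).elim
  pair := by
    have new : ∀ s k, s ≠ inr k → ¬ (GenTriangle.doubleSubdivision G p q).Adj s (inr k) →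
        ConnOn (GenTriangle.doubleSubdivision G p q) {s, inr k}ᶜ := by
      intro s k h1 h2
      rcases hG.conn_delete_new hpq s k with h | h | h
      · exact h
      · exact (h2 h).elim
      · exact (h1 h).elim
    rintro (s | k) (t | l) hst hadj
    · have hst' : s ≠ t := by simpa using hst
      by_cases h : G.Adj s t
      · have he : s(s, t) = s(p, q) := by
          by_contra he
          exact hadj ((doubleSubdivision_inl_inl s t).2 ⟨h, he⟩)
        right
        have key : ∀ {p q : V}, G.Adj p q →
            ∃ c, Split (GenTriangle.doubleSubdivision G p q) (inl p) (inl q) c := by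
          intro p q hpq
          refine ⟨Sum.elim (fun _ => 2) (fun k => k.castSucc),
            (hG.edge p q hpq).split hpq _ 2 (fun _ => rfl) ?_ ?_⟩
          · exact fun k l h => Fin.castSucc_injective 2 h
          · exact fun k => Fin.castSucc_ne_last k
        rcases Sym2.eq_iff.1 he with ⟨rfl, rfl⟩ | ⟨rfl, rfl⟩
        · exact key hpq
        · rw [doubleSubdivision_comm]
          exact key hpq.symm
      · rcases hG.pair s t hst' h with hc | ⟨c, hc⟩
        · left
          have key : ∀ {p q : V}, G.Adj p q → p ≠ s → p ≠ t →
              ConnOn (GenTriangle.doubleSubdivision G p q) {inl s, inl t}ᶜ := by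
            intro p q hpq hs ht
            convert (doubleSubdivision_isContraction hpq).connOn hc using 1
            ext (v | k)
            · simp
            · simp [hs, ht]
          by_cases hp : p ≠ s ∧ p ≠ t
          · exact key hpq hp.1 hp.2
          · have hq : q ≠ s ∧ q ≠ t := by
              constructor
              · rintro rfl
                exact hp ⟨hpq.ne, by rintro rfl; exact h hpq.symm⟩
              · rintro rfl
                exact hp ⟨by rintro rfl; exact h hpq, hpq.ne⟩
            rw [doubleSubdivision_comm]
            exact key hpq.symm hq.1 hq.2
        · obtain ⟨c', hc', -⟩ := hc.doubleSubdivision hpq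
          exact .inr ⟨c', hc'⟩
    · exact .inl (new _ _ hst hadj)
    · rw [Set.pair_comm]
      exact .inl (new _ _ hst.symm fun h => hadj h.symm)
    · exact .inl (new _ _ hst hadj)

lemma Split.of_iso (e : G' ≃g G) {s t : V} {c : V → Fin 3} (h : Split G s t c) :
    Split G' (e.symm s) (e.symm t) (c ∘ e) :=
  (IsContraction.of_iso e).split (preimage_iso_singleton e s) (preimage_iso_singleton e t)
    (fun _ v hv => .inl ⟨e.symm v, by rw [hv, preimage_iso_singleton]⟩) h

lemma IsSplittable.of_iso (e : G' ≃g G) (hG : IsSplittable G) : IsSplittable G' := by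
  have hπ := IsContraction.of_iso e
  have hcompl : ∀ s t : V', (e : V' → V) ⁻¹' {e s, e t}ᶜ = {s, t}ᶜ := by
    intro s t
    ext v
    simp
  refine ⟨hπ.connOn hG.conn, fun s => ?_, fun s t hst => ?_, fun s t hst hadj => ?_⟩
  · convert hπ.connOn (hG.conn_one (e s)) using 1
    ext v
    simp
  · rw [← hcompl]
    exact hπ.good (by simp [preimage_iso_singleton]) (by simp [preimage_iso_singleton])
      (fun v hv => .inl ⟨e.symm v, by rw [hv, preimage_iso_singleton]⟩)
      (hG.edge _ _ (e.map_adj_iff.2 hst))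
  · rcases hG.pair (e s) (e t) (by simpa using hst) (by rwa [e.map_adj_iff]) with h | ⟨c, hc⟩
    · left
      rw [← hcompl]
      exact hπ.connOn h
    · exact .inr ⟨_, by simpa using hc.of_iso e⟩

lemma connOn_top (S : Set V) : ConnOn (⊤ : SimpleGraph V) S := by
  intro P hP v hv w hw hPv
  by_cases h : v = w
  · exact h ▸ hPv
  · exact hP v hv w hw h hPv

lemma isSplittable_triangle : IsSplittable (⊤ : SimpleGraph (Fin 3)) where
  conn := connOn_top _
  conn_one _ := connOn_top _
  edge s t hst := by
    obtain ⟨r, hs, ht, hr⟩ : ∃ r, s ≠ r ∧ t ≠ r ∧ ∀ v, v ≠ s → v ≠ t → v = r := by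
      revert s t
      decide
    refine ⟨connOn_top _, ⟨s, rfl, r, by simp [hs.symm, ht.symm], hs⟩,
      ⟨t, rfl, r, by simp [hs.symm, ht.symm], ht⟩, .inl ⟨r, ?_⟩⟩
    ext v
    simp only [Set.mem_compl_iff, Set.mem_insert_iff, Set.mem_singleton_iff, not_or]
    exact ⟨fun h => hr v h.1 h.2, fun h => h ▸ ⟨hs.symm, ht.symm⟩⟩
  pair s t hst hadj := (hadj hst).elim

lemma IsGeneralisedTriangle.isSplittable (hG : IsGeneralisedTriangle G) : IsSplittable G := by
  induction hG with
  | triangle G e => exact isSplittable_triangle.of_iso e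
  | subdivide G G' p q _ hpq e ih => exact (ih.doubleSubdivision hpq).of_iso e

end GenTriangle

namespace GenTriangle

universe u v
variable {V : Type u} {V' : Type v} {G : SimpleGraph V} {G' : SimpleGraph V'} {p q : V}

open Sum

/-! ### Separating three edges by a 2-cut. -/

/-- Three distinct edges `x i y i` between the disjoint connected sets `X` and `Y`. -/
structure ThreeEdges (G : SimpleGraph V) (X Y : Set V) (x y : Fin 3 → V) : Prop where
  connX : ConnOn G X
  connY : ConnOn G Y
  disj : Disjoint X Y
  memX : ∀ i, x i ∈ X
  memY : ∀ i, y i ∈ Y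
  adj : ∀ i, G.Adj (x i) (y i)
  inj : ∀ i j, x i = x j → y i = y j → i = j

lemma ThreeEdges.swap {X Y : Set V} {x y : Fin 3 → V} (h : ThreeEdges G X Y x y) :
    ThreeEdges G Y X y x :=
  ⟨h.connY, h.connX, h.disj.symm, h.memY, h.memX, fun i => (h.adj i).symm,
    fun i j h1 h2 => h.inj i j h2 h1⟩

/-- Any three distinct edges between disjoint connected sets `X` and `Y` lie in different bridges
of some 2-cut consisting of a vertex of `X` and a vertex of `Y`. -/
def SplitsThreeEdges (G : SimpleGraph V) : Prop :=
  ∀ X Y x y, ThreeEdges G X Y x y → ∃ s ∈ X, ∃ t ∈ Y, ∃ c, Split G s t c ∧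
    ∀ i, (x i ≠ s → c (x i) = i) ∧ (y i ≠ t → c (y i) = i)

/-- Vacuous: at most two edges of a triangle run between two disjoint sets of vertices. -/
lemma splitsThreeEdges_triangle : SplitsThreeEdges (⊤ : SimpleGraph (Fin 3)) := by
  intro X Y x y h
  exfalso
  have ne : ∀ i j, x i ≠ y j := fun i j e =>
    Set.disjoint_left.1 h.disj (h.memX i) (e ▸ h.memY j)
  have key : ∀ x₀ x₁ x₂ y₀ y₁ y₂ : Fin 3, x₀ ≠ y₀ → x₀ ≠ y₁ → x₀ ≠ y₂ → x₁ ≠ y₀ → x₁ ≠ y₁ →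
      x₁ ≠ y₂ → x₂ ≠ y₀ → x₂ ≠ y₁ → x₂ ≠ y₂ → (x₀ = x₁ ∧ y₀ = y₁) ∨ (x₀ = x₂ ∧ y₀ = y₂) ∨
      (x₁ = x₂ ∧ y₁ = y₂) := by
    decide
  rcases key (x 0) (x 1) (x 2) (y 0) (y 1) (y 2) (ne _ _) (ne _ _) (ne _ _) (ne _ _) (ne _ _)
    (ne _ _) (ne _ _) (ne _ _) (ne _ _) with ⟨h1, h2⟩ | ⟨h1, h2⟩ | ⟨h1, h2⟩
  · simpa using h.inj _ _ h1 h2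
  · simpa using h.inj _ _ h1 h2
  · simpa using h.inj _ _ h1 h2

lemma SplitsThreeEdges.of_iso (e : G' ≃g G) (h : SplitsThreeEdges G) : SplitsThreeEdges G' := by
  intro X Y x y hxy
  have hπ := IsContraction.of_iso e.symm
  obtain ⟨s, hs, t, ht, c, hc, hi⟩ := h (e.symm ⁻¹' X) (e.symm ⁻¹' Y) (e ∘ x) (e ∘ y)
    ⟨hπ.connOn hxy.connX, hπ.connOn hxy.connY, hxy.disj.preimage _,
      fun i => by simpa using hxy.memX i, fun i => by simpa using hxy.memY i,
      fun i => e.map_adj_iff.2 (hxy.adj i),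
      fun i j h1 h2 => hxy.inj i j (e.injective h1) (e.injective h2)⟩
  refine ⟨e.symm s, hs, e.symm t, ht, _, hc.of_iso e, fun i => ⟨fun h' => (hi i).1 ?_,
    fun h' => (hi i).2 ?_⟩⟩
  · rintro rfl
    simp at h'
  · rintro rfl
    simp at h'

lemma ConnOn.of_doubleSubdivision {X : Set (V ⊕ Fin 2)} (hpq : G.Adj p q)
    (h : ConnOn (doubleSubdivision G p q) X) : ConnOn G (inl ⁻¹' X) := by
  intro P hP v hv w hw hPv
  -- A new vertex only transmits `P` between `p` and `q`, which are adjacent in `G`. So it is given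
  -- the property that `P` holds at one of these ends inside `X`.
  refine h (Sum.elim P fun _ => (inl p ∈ X ∧ P p) ∨ (inl q ∈ X ∧ P q)) ?_ (inl v) hv (inl w) hw hPv
  rintro (a | k) ha (b | l) hb hab
  · exact hP a ha b hb ((doubleSubdivision_inl_inl a b).1 hab).1
  · rcases hab with rfl | rfl
    · exact fun h => .inl ⟨ha, h⟩
    · exact fun h => .inr ⟨ha, h⟩
  · rcases hab with rfl | rfl
    · rintro (⟨-, h⟩ | ⟨h', h⟩)
      · exact h
      · exact hP q h' b hb hpq.symm h
    · rintro (⟨h', h⟩ | ⟨-, h⟩)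
      · exact hP p h' b hb hpq h
      · exact h
  · exact (doubleSubdivision_inr_inr _ _ hab).elim

/-- An edge from `X` to `Y` that starts at one of the new vertices comes from the edge `pq`. -/
lemma ThreeEdges.old_of_new {X Y : Set (V ⊕ Fin 2)} {x y : Fin 3 → V ⊕ Fin 2}
    (h : ThreeEdges (doubleSubdivision G p q) X Y x y) {i : Fin 3} {k : Fin 2} (hk : x i = inr k) :
    ∃ a b, ((a = p ∧ b = q) ∨ (a = q ∧ b = p)) ∧ inl a ∈ X ∧ y i = inl b := by
  have nbr : ∀ z, (doubleSubdivision G p q).Adj (inr k) z → z = inl p ∨ z = inl q := by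
    rintro (z | l) hz
    · simpa using hz
    · exact (doubleSubdivision_inr_inr _ _ hz).elim
  have hkX : inr k ∈ X := hk ▸ h.memX i
  -- Otherwise all three edges would start at `inr k`, which has only two neighbours.
  obtain ⟨z, hzX, hz⟩ : ∃ z ∈ X, z ≠ inr k := by
    by_contra! hall
    have hx : ∀ j, x j = inr k := fun j => hall _ (h.memX j)
    have hy : ∀ j, y j = inl p ∨ y j = inl q := fun j => nbr _ (hx j ▸ h.adj j)
    have inj : ∀ i j, y i = y j → i = j := fun i j => h.inj i j ((hx i).trans (hx j).symm)
    rcases hy 0 with h0 | h0 <;> rcases hy 1 with h1 | h1 <;> rcases hy 2 with h2 | h2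
    · simpa using inj 0 1 (h0.trans h1.symm)
    · simpa using inj 0 1 (h0.trans h1.symm)
    · simpa using inj 0 2 (h0.trans h2.symm)
    · simpa using inj 1 2 (h1.trans h2.symm)
    · simpa using inj 1 2 (h1.trans h2.symm)
    · simpa using inj 0 2 (h0.trans h2.symm)
    · simpa using inj 0 1 (h0.trans h1.symm)
    · simpa using inj 0 1 (h0.trans h1.symm)
  have hX : inl p ∈ X ∨ inl q ∈ X := by
    by_contra! hno
    refine hz (h.connX (fun w => w = inr k) ?_ (inr k) hkX z hzX rfl)
    rintro v hv w hw hvw rfl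
    rcases nbr w hvw with rfl | rfl
    · exact (hno.1 hw).elim
    · exact (hno.2 hw).elim
  have ne : ∀ a, inl a ∈ X → y i ≠ inl a := fun a ha e =>
    Set.disjoint_left.1 h.disj ha (e ▸ h.memY i)
  rcases nbr _ (hk ▸ h.adj i) with hy | hy <;> rcases hX with hX | hX
  · exact (ne p hX hy).elim
  · exact ⟨q, p, .inr ⟨rfl, rfl⟩, hX, hy⟩
  · exact ⟨p, q, .inl ⟨rfl, rfl⟩, hX, hy⟩
  · exact (ne q hX hy).elim

/-- `(a, b)` is the edge of `G` that the edge `xy` of the double subdivision comes from, and `xy`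
contains the new vertex `k`. -/
def IsNew (p q a b : V) (x y : V ⊕ Fin 2) (k : Fin 2) : Prop :=
  ((a = p ∧ b = q) ∨ (a = q ∧ b = p)) ∧ ((x = inr k ∧ y = inl b) ∨ (x = inl a ∧ y = inr k))

lemma ThreeEdges.exists_old {X Y : Set (V ⊕ Fin 2)} {x y : Fin 3 → V ⊕ Fin 2}
    (h : ThreeEdges (doubleSubdivision G p q) X Y x y) (i : Fin 3) :
    ∃ a b, inl a ∈ X ∧ inl b ∈ Y ∧ ((x i = inl a ∧ y i = inl b) ∨ ∃ k, IsNew p q a b (x i) (y i) k) := by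
  have hX := h.memX i
  have hY := h.memY i
  rcases hx : x i with a | k
  · rcases hy : y i with b | k
    · exact ⟨a, b, hx ▸ hX, hy ▸ hY, .inl ⟨rfl, rfl⟩⟩
    · obtain ⟨b, a', hab, hb, ha'⟩ := h.swap.old_of_new hy
      obtain rfl : a = a' := inl_injective (hx.symm.trans ha')
      exact ⟨a, b, hx ▸ hX, hb, .inr ⟨k, by tauto, .inr ⟨rfl, rfl⟩⟩⟩
  · obtain ⟨a, b, hab, ha, hb⟩ := h.old_of_new hx
    exact ⟨a, b, ha, hb ▸ hY, .inr ⟨k, hab, .inl ⟨rfl, hb⟩⟩⟩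

/-- Each edge is replaced by the edge of `G` that it comes from. If two of them come from `pq`, the
cut is `{p, q}` itself. Otherwise the three old edges are distinct, and the cut that separates them
in `G` persists. -/
lemma SplitsThreeEdges.doubleSubdivision (hG : IsSplittable G) (h : SplitsThreeEdges G)
    (hpq : G.Adj p q) : SplitsThreeEdges (GenTriangle.doubleSubdivision G p q) := by
  intro X Y x y hxy
  have old : ∀ i, ∃ a b, inl a ∈ X ∧ inl b ∈ Y ∧
      ((x i = inl a ∧ y i = inl b) ∨ ∃ k, IsNew p q a b (x i) (y i) k) := hxy.exists_old
  choose a b ha hb hab using old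
  have disj : ∀ i j, a i ≠ b j := fun i j e =>
    Set.disjoint_left.1 hxy.disj (ha i) (e ▸ hb j)
  have same : ∀ i j k l, IsNew p q (a i) (b i) (x i) (y i) k →
      IsNew p q (a j) (b j) (x j) (y j) l → a i = a j ∧ b i = b j := by
    rintro i j k l ⟨hi, -⟩ ⟨hj, -⟩
    have h1 := disj i j
    have h2 := disj j i
    rcases hi with ⟨e1, e2⟩ | ⟨e1, e2⟩ <;> rcases hj with ⟨e3, e4⟩ | ⟨e3, e4⟩ <;>
      simp_all
  have newInj : ∀ i j k, IsNew p q (a i) (b i) (x i) (y i) k →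
      IsNew p q (a j) (b j) (x j) (y j) k → i = j := by
    intro i j k hi hj
    obtain ⟨e1, e2⟩ := same i j k k hi hj
    have nXY : ∀ i j, x i ≠ y j := fun i j e =>
      Set.disjoint_left.1 hxy.disj (hxy.memX i) (e ▸ hxy.memY j)
    rcases hi.2 with hi | hi <;> rcases hj.2 with hj | hj
    · exact hxy.inj i j (hi.1.trans hj.1.symm) (by rw [hi.2, hj.2, e2])
    · exact (nXY i j (hi.1.trans hj.2.symm)).elim
    · exact (nXY j i (hj.1.trans hi.2.symm)).elim
    · exact hxy.inj i j (by rw [hi.1, hj.1, e1]) (hi.2.trans hj.2.symm)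
  by_cases two : ∃ i j k l, i ≠ j ∧ IsNew p q (a i) (b i) (x i) (y i) k ∧
      IsNew p q (a j) (b j) (x j) (y j) l
  · obtain ⟨i, j, k, l, hij, hi, hj⟩ := two
    -- The two edges use different new vertices, which leaves none for the third edge `m`. The new
    -- vertices are coloured `i` and `j`, the old ones `m`.
    have hkl : k ≠ l := by
      rintro rfl
      exact hij (newInj i j k hi hj)
    obtain ⟨m, hmi, hmj, hm⟩ : ∃ m, m ≠ i ∧ m ≠ j ∧ ∀ n, n = m ∨ n = i ∨ n = j := by
      clear hi hj
      revert i j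
      decide
    have hk : ∀ n, n = k ∨ n = l := by omega
    have oldm : x m = inl (a m) ∧ y m = inl (b m) := by
      rcases hab m with hab | ⟨n, hn⟩
      · exact hab
      · rcases hk n with rfl | rfl
        · exact (hmi (newInj m i _ hn hi)).elim
        · exact (hmj (newInj m j _ hn hj)).elim
    have key : ∀ {p q : V}, G.Adj p q → Split (GenTriangle.doubleSubdivision G p q) (inl p) (inl q)
        (Sum.elim (fun _ => m) fun n => if n = k then i else j) := by
      intro p q hpq
      refine (hG.edge p q hpq).split hpq _ m (fun _ => rfl) ?_ ?_
      · intro n n'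
        simp only [Sum.elim_inr]
        rcases hk n with rfl | rfl <;> rcases hk n' with rfl | rfl <;> simp [hkl.symm, hij, hij.symm]
      · intro n
        simp only [Sum.elim_inr]
        split_ifs
        · exact hmi.symm
        · exact hmj.symm
    have split : Split (GenTriangle.doubleSubdivision G p q) (inl (a i)) (inl (b i))
        (Sum.elim (fun _ => m) fun n => if n = k then i else j) := by
      rcases hi.1 with ⟨e1, e2⟩ | ⟨e1, e2⟩
      · rw [e1, e2]
        exact key hpq
      · rw [e1, e2, doubleSubdivision_comm]
        exact key hpq.symm
    refine ⟨inl (a i), ha i, inl (b i), hb i, _, split, fun n => ?_⟩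
    obtain ⟨e1, e2⟩ := same i j k l hi hj
    rcases hm n with rfl | rfl | rfl
    · simp [oldm]
    · rcases hi.2 with h' | h' <;> simp [h']
    · rcases hj.2 with h' | h' <;> simp [h', e1, e2, hkl.symm]
  · have inj : ∀ i j, a i = a j → b i = b j → i = j := by
      intro i j h1 h2
      have hadj : ∀ i j, a i = a j → b i = b j → (x i = inl (a i) ∧ y i = inl (b i)) →
          ∀ k, ¬ IsNew p q (a j) (b j) (x j) (y j) k := by
        rintro i j h1 h2 ⟨h3, h4⟩ k ⟨h5, -⟩
        have := hxy.adj i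
        rw [h3, h4, doubleSubdivision_inl_inl, h1, h2] at this
        rcases h5 with ⟨h5, h6⟩ | ⟨h5, h6⟩ <;> simp [h5, h6] at this
      rcases hab i with hi | ⟨k, hi⟩ <;> rcases hab j with hj | ⟨l, hj⟩
      · exact hxy.inj i j (by rw [hi.1, hj.1, h1]) (by rw [hi.2, hj.2, h2])
      · exact (hadj i j h1 h2 hi l hj).elim
      · exact (hadj j i h1.symm h2.symm hj k hi).elim
      · by_contra hij
        exact two ⟨i, j, k, l, hij, hi, hj⟩
    obtain ⟨s, hs, t, ht, c, hc, hi⟩ := h (inl ⁻¹' X) (inl ⁻¹' Y) a b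
      ⟨hxy.connX.of_doubleSubdivision hpq, hxy.connY.of_doubleSubdivision hpq,
        hxy.disj.preimage _, ha, hb, fun i => by
          rcases hab i with hi | ⟨k, hi, -⟩
          · have := hxy.adj i
            rw [hi.1, hi.2, doubleSubdivision_inl_inl] at this
            exact this.1
          · rcases hi with ⟨e1, e2⟩ | ⟨e1, e2⟩ <;> rw [e1, e2]
            · exact hpq
            · exact hpq.symm, inj⟩
    obtain ⟨c', hc', hold, hnew⟩ := hc.doubleSubdivision hpq
    have has : ∀ i, a i ≠ t := fun i e => Set.disjoint_left.1 hxy.disj (ha i) (e ▸ ht)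
    have hbs : ∀ i, b i ≠ s := fun i e => Set.disjoint_left.1 hxy.disj hs (e ▸ hb i)
    -- The adjacent vertices `a i`, `b i` cannot be the two cut vertices. One of them is therefore
    -- off the cut, has colour `i`, and passes it to the new vertex.
    have hk : ∀ i k, IsNew p q (a i) (b i) (x i) (y i) k → c' (inr k) = i := by
      rintro i k ⟨hi', -⟩
      by_cases hai : a i = s
      · have hbi : b i ≠ t := by
          rintro hbi
          refine hc.not_adj ?_
          rw [← hai, ← hbi]
          rcases hi' with ⟨e1, e2⟩ | ⟨e1, e2⟩ <;> rw [e1, e2]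
          · exact hpq
          · exact hpq.symm
        rw [hnew k (b i) (by tauto) (hbs i) hbi, (hi i).2 hbi]
      · rw [hnew k (a i) (by tauto) hai (has i), (hi i).1 hai]
    refine ⟨inl s, hs, inl t, ht, c', hc', fun i => ?_⟩
    rcases hab i with hi' | ⟨k, hi'⟩
    · rw [hi'.1, hi'.2, hold, hold]
      simpa using hi i
    · have := hk i k hi'
      rcases hi'.2 with ⟨e1, e2⟩ | ⟨e1, e2⟩
      · rw [e1, e2, hold]
        exact ⟨fun _ => this, fun h' => (hi i).2 (by simpa using h')⟩
      · rw [e1, e2, hold]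
        exact ⟨fun h' => (hi i).1 (by simpa using h'), fun _ => this⟩

lemma IsGeneralisedTriangle.splitsThreeEdges (hG : IsGeneralisedTriangle G) :
    SplitsThreeEdges G := by
  induction hG with
  | triangle G e => exact splitsThreeEdges_triangle.of_iso e
  | subdivide G G' p q hG hpq e ih => exact (ih.doubleSubdivision hG.isSplittable hpq).of_iso e

end GenTriangle

namespace GenTriangle

universe u v
variable {V : Type u} {W : Type v} {G : SimpleGraph V}

/-! ### From the minors to a 2-cut without trivial bridge. -/

/-- Sets `X`, `Y`, `A i`, `D i` that model three paths of length three with common ends. -/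
structure ThetaModel (G : SimpleGraph V) (X Y : Set V) (A D : Fin 3 → Set V) : Prop where
  connX : ConnOn G X
  connY : ConnOn G Y
  connA : ∀ i, ConnOn G (A i)
  connD : ∀ i, ConnOn G (D i)
  touchA : ∀ i, Touch G X (A i)
  touchD : ∀ i, Touch G Y (D i)
  touch : ∀ i, Touch G (A i) (D i)
  disjXY : Disjoint X Y
  disjXD : ∀ i, Disjoint X (D i)
  disjYA : ∀ i, Disjoint Y (A i)
  disjAD : ∀ i j, Disjoint (A i) (D j)
  disjXA : ∀ i, Disjoint X (A i)
  disjYD : ∀ i, Disjoint Y (D i)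
  disjA : ∀ i j, i ≠ j → Disjoint (A i) (A j)
  disjD : ∀ i j, i ≠ j → Disjoint (D i) (D j)

lemma ThetaModel.swap {X Y : Set V} {A D : Fin 3 → Set V} (h : ThetaModel G X Y A D) :
    ThetaModel G Y X D A :=
  ⟨h.connY, h.connX, h.connD, h.connA, h.touchD, h.touchA, fun i => (h.touch i).symm, h.disjXY.symm,
    h.disjYA, h.disjXD, fun i j => (h.disjAD j i).symm, h.disjYD, h.disjXA, h.disjD, h.disjA⟩

lemma ThetaModel.disjoint_union {X Y : Set V} {A D : Fin 3 → Set V} (h : ThetaModel G X Y A D) :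
    Disjoint (X ∪ ⋃ i ∈ Set.univ, A i) (Y ∪ ⋃ i ∈ Set.univ, D i) := by
  simp only [Set.mem_univ, Set.iUnion_true, Set.disjoint_union_left, Set.disjoint_union_right,
    Set.disjoint_iUnion_left, Set.disjoint_iUnion_right]
  exact ⟨⟨h.disjXY, fun i => (h.disjYA i).symm⟩, fun i => ⟨h.disjXD i, fun j => h.disjAD j i⟩⟩

/-- A 2-cut that separates the three paths of a theta model has a vertex in `X`. -/
lemma ThetaModel.cut_mem {X Y : Set V} {A D : Fin 3 → Set V} (h : ThetaModel G X Y A D)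
    {s t : V} {c : V → Fin 3} (hc : Split G s t c)
    (hs : s ∈ X ∪ ⋃ i ∈ Set.univ, A i) (ht : t ∈ Y ∪ ⋃ i ∈ Set.univ, D i) {x : Fin 3 → V}
    (hx : ∀ i, x i ∈ A i) (hcx : ∀ i, x i ≠ s → c (x i) = i) : s ∈ X := by
  rcases hs with hs | hs
  · exact hs
  exfalso
  obtain ⟨i, -, hi⟩ := Set.mem_iUnion₂.1 hs
  obtain ⟨j, k, hj, hk, hjk⟩ : ∃ j k, j ≠ i ∧ k ≠ i ∧ j ≠ k := by
    clear hi
    revert i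
    decide
  have nA : ∀ j, j ≠ i → s ∉ A j := fun j hj hsj => Set.disjoint_left.1 (h.disjA j i hj) hsj hi
  have mem : ∀ j, j ≠ i → x j ∈ X ∪ ⋃ j ∈ {j | j ≠ i}, A j := fun j hj =>
    .inr (Set.mem_iUnion₂.2 ⟨j, hj, hx j⟩)
  have hsub : X ∪ ⋃ j ∈ {j | j ≠ i}, A j ⊆ X ∪ ⋃ i ∈ Set.univ, A i :=
    Set.union_subset_union_right _ (Set.biUnion_subset_biUnion_left (Set.subset_univ _))
  -- Were `s` in `A i`, the set `X` with the other two `A j` would be connected and avoid the cut,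
  -- yet it contains vertices of two colours.
  have e : c (x j) = c (x k) := by
    refine hc.eq_of_connOn (h.connX.union_biUnion {j | j ≠ i} h.connA h.touchA) ?_ ?_
      (mem j hj) (mem k hk)
    · rintro (hs | hs)
      · exact Set.disjoint_left.1 (h.disjXA i) hs hi
      · obtain ⟨l, hl, hsl⟩ := Set.mem_iUnion₂.1 hs
        exact nA l hl hsl
    · exact fun ht' => Set.disjoint_left.1 h.disjoint_union (hsub ht') ht
  rw [hcx j fun e => nA j hj (e ▸ hx j), hcx k fun e => nA k hk (e ▸ hx k)] at e
  exact hjk e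

/-- If three paths of length three with common ends form a minor of `G`, then some 2-cut has no
trivial bridge. -/
lemma ThetaModel.exists_split {X Y : Set V} {A D : Fin 3 → Set V} (h : ThetaModel G X Y A D)
    (hG : SplitsThreeEdges G) :
    ∃ s t c, Split G s t c ∧ ∀ i v, cls c s t i ≠ {v} := by
  choose x hx y hy hxy using h.touch
  have sub : ∀ (S : Set V) (F : Fin 3 → Set V) i, F i ⊆ S ∪ ⋃ i ∈ Set.univ, F i := fun S F i =>
    (Set.subset_biUnion_of_mem (u := F) (Set.mem_univ i)).trans Set.subset_union_right
  obtain ⟨s, hs, t, ht, c, hc, hi⟩ := hG _ _ x y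
    { connX := h.connX.union_biUnion Set.univ h.connA h.touchA
      connY := h.connY.union_biUnion Set.univ h.connD h.touchD
      disj := h.disjoint_union
      memX := fun i => sub _ _ i (hx i)
      memY := fun i => sub _ _ i (hy i)
      adj := hxy
      inj := fun i j e _ => by
        by_contra hij
        exact Set.disjoint_left.1 (h.disjA i j hij) (hx i) (e ▸ hx j) }
  have hsX : s ∈ X := h.cut_mem hc hs ht hx fun i => (hi i).1
  have htY : t ∈ Y := h.swap.cut_mem hc.swap ht hs hy fun i => (hi i).2
  refine ⟨s, t, c, hc, fun i v hv => ?_⟩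
  have xs : x i ≠ s := fun e => Set.disjoint_left.1 (h.disjXA i) hsX (e ▸ hx i)
  have xt : x i ≠ t := fun e => Set.disjoint_left.1 (h.disjYA i) htY (e ▸ hx i)
  have ys : y i ≠ s := fun e => Set.disjoint_left.1 (h.disjXD i) hsX (e ▸ hy i)
  have yt : y i ≠ t := fun e => Set.disjoint_left.1 (h.disjYD i) htY (e ▸ hy i)
  have h1 : x i ∈ cls c s t i := ⟨xs, xt, (hi i).1 xs⟩
  have h2 : y i ∈ cls c s t i := ⟨ys, yt, (hi i).2 yt⟩
  rw [hv] at h1 h2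
  exact (hxy i).ne ((show x i = v from h1).trans (show y i = v from h2).symm)

/-- The conditions say that `H` contains the paths `x`, `a i`, `d i`, `y`, with only their ends in
common. They are left to `decide` for `H1` and `H2`. -/
lemma IsMinor.exists_split {H : SimpleGraph W} (hH : IsMinor H G) (hG : SplitsThreeEdges G)
    (x y : W) (a d : Fin 3 → W) (hxa : ∀ i, H.Adj x (a i)) (hyd : ∀ i, H.Adj y (d i))
    (had : ∀ i, H.Adj (a i) (d i)) (hxy : x ≠ y) (hxd : ∀ i, x ≠ d i) (hya : ∀ i, y ≠ a i)
    (hne : ∀ i j, a i ≠ d j) (ha : ∀ i j, i ≠ j → a i ≠ a j) (hd : ∀ i j, i ≠ j → d i ≠ d j) :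
    ∃ s t c, Split G s t c ∧ ∀ i v, cls c s t i ≠ {v} := by
  obtain ⟨B, hconn, hdisj, hadj⟩ := hH
  have conn : ∀ w, ConnOn G (B w) := fun w => .of_connected (hconn w).preconnected
  refine ThetaModel.exists_split (X := B x) (Y := B y) (A := fun i => B (a i))
    (D := fun i => B (d i)) ?_ hG
  exact ⟨conn _, conn _, fun _ => conn _, fun _ => conn _, fun i => hadj _ _ (hxa i),
    fun i => hadj _ _ (hyd i), fun i => hadj _ _ (had i), hdisj _ _ hxy, fun i => hdisj _ _ (hxd i),
    fun i => hdisj _ _ (hya i), fun i j => hdisj _ _ (hne i j), fun i => hdisj _ _ (hxa i).ne,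
    fun i => hdisj _ _ (hyd i).ne, fun i j h => hdisj _ _ (ha i j h),
    fun i j h => hdisj _ _ (hd i j h)⟩

instance doubleSubdivision.decidableAdj [DecidableEq V] [DecidableRel G.Adj] (p q : V) :
    DecidableRel (doubleSubdivision G p q).Adj
  | .inl a, .inl b => decidable_of_iff _ (doubleSubdivision_inl_inl a b).symm
  | .inl a, .inr k => decidable_of_iff _ (doubleSubdivision_inl_inr a k).symm
  | .inr k, .inl b => decidable_of_iff _ (doubleSubdivision_inr_inl b k).symm
  | .inr k, .inr l => .isFalse (doubleSubdivision_inr_inr k l)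

instance : DecidableRel K23.Adj := fun a b =>
  inferInstanceAs (Decidable (a.isLeft ∧ b.isRight ∨ a.isRight ∧ b.isLeft))

open Sum

lemma exists_split_of_isMinor_H1 (hH : IsMinor H1 G) (hG : SplitsThreeEdges G) :
    ∃ s t c, Split G s t c ∧ ∀ i v, cls c s t i ≠ {v} := by
  unfold H1 at hH
  exact hH.exists_split hG (inl (inl (inl (inl 0)))) (inl (inl (inl (inl 1))))
    ![inl (inl (inr 0)), inl (inr 0), inr 0] (fun i => inl (inl (inl (inr i))))
    (by decide) (by decide) (by decide) (by decide) (by decide) (by decide) (by decide)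
    (by decide) (by decide)

/-- Two paths run through a doubled edge at `x`. The third goes through `w` before the new vertex on
`wy`. -/
lemma exists_split_of_isMinor_H2 (hH : IsMinor H2 G) (hG : SplitsThreeEdges G) :
    ∃ s t c, Split G s t c ∧ ∀ i v, cls c s t i ≠ {v} := by
  unfold H2 at hH
  exact hH.exists_split hG (inl (inl (inl (inl 0)))) (inl (inl (inl (inl 1))))
    ![inl (inl (inr 0)), inl (inr 0), inl (inl (inl (inr 2)))]
    ![inl (inl (inl (inr 0))), inl (inl (inl (inr 1))), inr 0]
    (by decide) (by decide) (by decide) (by decide) (by decide) (by decide) (by decide)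
    (by decide) (by decide)

/-! ### From a 2-cut without trivial bridge to the minors. -/

/-- The edges of `K₂,₃` with, for each `i`, the edge from `ε i` to the `i`-th vertex of the larger
part doubly subdivided. The vertices `(i, 0)`, `(i, 1)` are the new ones, `(i, 2)` is the old one. -/
def SlotAdj (ε : Fin 3 → Fin 2) : Fin 2 ⊕ (Fin 3 × Fin 3) → Fin 2 ⊕ (Fin 3 × Fin 3) → Prop
  | inl k, inr (i, r) => (k = ε i ∧ r ≠ 2) ∨ (k ≠ ε i ∧ r = 2)
  | inr (i, r), inr (j, r') => i = j ∧ r ≠ 2 ∧ r' = 2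
  | _, _ => False

instance (ε : Fin 3 → Fin 2) : DecidableRel (SlotAdj ε)
  | inl k, inr (i, r) => inferInstanceAs (Decidable ((k = ε i ∧ r ≠ 2) ∨ (k ≠ ε i ∧ r = 2)))
  | inr (i, r), inr (j, r') => inferInstanceAs (Decidable (i = j ∧ r ≠ 2 ∧ r' = 2))
  | inl _, inl _ => inferInstanceAs (Decidable False)
  | inr _, inl _ => inferInstanceAs (Decidable False)

lemma isMinor_of_rooted {H : SimpleGraph W} (f : W → Fin 2 ⊕ (Fin 3 × Fin 3)) (ε : Fin 3 → Fin 2)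
    (hf : ∀ v w, f v = f w → v = w)
    (hadj : ∀ v w, H.Adj v w → SlotAdj ε (f v) (f w) ∨ SlotAdj ε (f w) (f v))
    (r : Fin 2 → V) (hr : r 0 ≠ r 1) (C : Fin 3 → Set V) (hC : ∀ i j, i ≠ j → Disjoint (C i) (C j))
    (hrC : ∀ k i, r k ∉ C i) (h : ∀ i, Rooted G (r (ε i)) (r (1 - ε i)) (C i)) : IsMinor H G := by
  choose A B U hsub hdisj hconn h1 h2 h3 h4 h5 using h
  let M : Fin 2 ⊕ (Fin 3 × Fin 3) → Set V :=
    Sum.elim (fun k => {r k}) fun z => ![A z.1, B z.1, U z.1] z.2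
  have cases3 : ∀ {P : Fin 3 → Prop}, P 0 → P 1 → P 2 → ∀ k, P k := fun h0 h1 h2 k => by
    fin_cases k <;> assumption
  have subM : ∀ i k, M (inr (i, k)) ⊆ C i := fun i =>
    cases3 (hsub i).1 (hsub i).2.1 (hsub i).2.2
  have disjM : ∀ a b, a ≠ b → Disjoint (M a) (M b) := by
    rintro (a | ⟨i, k⟩) (b | ⟨j, l⟩) hab
    · have hab' : a ≠ b := by simpa using hab
      have : r a ≠ r b := by
        fin_cases a <;> fin_cases b
        · exact (hab' rfl).elim
        · exact hr
        · exact hr.symm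
        · exact (hab' rfl).elim
      simpa [M] using this
    · exact Set.disjoint_singleton_left.2 fun h' => hrC _ _ (subM _ _ h')
    · exact Set.disjoint_singleton_right.2 fun h' => hrC _ _ (subM _ _ h')
    · by_cases hij : i = j
      · subst hij
        obtain ⟨d1, d2, d3⟩ := hdisj i
        have hkl : k ≠ l := by
          rintro rfl
          exact hab rfl
        clear hab
        fin_cases k <;> fin_cases l
        · exact (hkl rfl).elim
        · exact d1
        · exact d2
        · exact d1.symm
        · exact (hkl rfl).elim
        · exact d3
        · exact d2.symm
        · exact d3.symm
        · exact (hkl rfl).elim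
      · exact (hC i j hij).mono (subM i k) (subM j l)
  have touchM : ∀ a b, SlotAdj ε a b → Touch G (M a) (M b) := by
    rintro (a | ⟨i, k⟩) (b | ⟨j, l⟩) hab
    · exact hab.elim
    · rcases hab with ⟨rfl, hl⟩ | ⟨ha, rfl⟩
      · fin_cases l
        · exact h1 j
        · exact h2 j
        · exact (hl rfl).elim
      · obtain rfl : a = 1 - ε j := by omega
        exact h5 j
    · exact hab.elim
    · obtain ⟨rfl, hk, rfl⟩ := hab
      fin_cases k
      · exact h3 i
      · exact h4 i
      · exact (hk rfl).elim
  have connM : ∀ a, (G.induce (M a)).Connected := by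
    rintro (k | ⟨i, k⟩)
    · exact (connOn_singleton (r k)).connected (Set.singleton_nonempty _)
    · obtain ⟨c1, c2, c3⟩ := hconn i
      revert k
      exact cases3 (c1.connected (h1 i).nonempty_right) (c2.connected (h2 i).nonempty_right)
        (c3.connected (h3 i).nonempty_right)
  refine ⟨fun w => M (f w), fun w => connM _, fun a b hab => disjM _ _ fun e => hab (hf a b e),
    fun a b hab => ?_⟩
  rcases hadj a b hab with h' | h'
  · exact touchM _ _ h'
  · exact (touchM _ _ h').symm

/-- The branch sets that the vertices of `H1` and `H2` are assigned to. -/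
def slot : (((Fin 2 ⊕ Fin 3) ⊕ Fin 2) ⊕ Fin 2) ⊕ Fin 2 → Fin 2 ⊕ (Fin 3 × Fin 3)
  | inl (inl (inl (inl k))) => inl k
  | inl (inl (inl (inr i))) => inr (i, 2)
  | inl (inl (inr k)) => inr (0, k.castSucc)
  | inl (inr k) => inr (1, k.castSucc)
  | inr k => inr (2, k.castSucc)

lemma slot_injective : ∀ v w, slot v = slot w → v = w := by
  decide

set_option synthInstance.maxSize 1000 in
set_option synthInstance.maxHeartbeats 200000 in
lemma slotAdj_H1 : ∀ v w, H1.Adj v w → SlotAdj (fun _ => 0) (slot v) (slot w) ∨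
    SlotAdj (fun _ => 0) (slot w) (slot v) := by
  unfold H1
  decide

set_option synthInstance.maxSize 1000 in
set_option synthInstance.maxHeartbeats 200000 in
lemma slotAdj_H2 : ∀ v w, H2.Adj v w → SlotAdj ![0, 0, 1] (slot v) (slot w) ∨
    SlotAdj ![0, 0, 1] (slot w) (slot v) := by
  unfold H2
  decide

lemma isMinor_H1 {s t : V} {C : Fin 3 → Set V} (hst : s ≠ t)
    (hC : ∀ i j, i ≠ j → Disjoint (C i) (C j)) (hs : ∀ i, s ∉ C i) (ht : ∀ i, t ∉ C i)
    (h : ∀ i, Rooted G s t (C i)) : IsMinor H1 G := by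
  refine isMinor_of_rooted slot _ slot_injective slotAdj_H1 ![s, t] hst C hC ?_ h
  intro k i
  fin_cases k
  · exact hs i
  · exact ht i

lemma isMinor_H2 {s t : V} {C : Fin 3 → Set V} (hst : s ≠ t)
    (hC : ∀ i j, i ≠ j → Disjoint (C i) (C j)) (hs : ∀ i, s ∉ C i) (ht : ∀ i, t ∉ C i)
    {i j k : Fin 3} (hij : i ≠ j) (hik : i ≠ k) (hjk : j ≠ k)
    (hi : Rooted G s t (C i)) (hj : Rooted G s t (C j)) (hk : Rooted G t s (C k)) :
    IsMinor H2 G := by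
  refine isMinor_of_rooted slot _ slot_injective slotAdj_H2 ![s, t] hst
    (fun l => C (![i, j, k] l)) ?_ ?_ ?_
  · intro a b hab
    refine hC _ _ ?_
    fin_cases a <;> fin_cases b <;> simp_all [Ne.symm]
  · intro a b
    fin_cases a
    · exact hs _
    · exact ht _
  · intro l
    fin_cases l
    · exact hi
    · exact hj
    · exact hk

/-- Each class is rooted in one of two orientations. If all three agree the minor is `H1`; otherwise
two agree against the third and it is `H2`. In both cases `s` and `t` may have to be exchanged. -/
lemma Split.isMinor {s t : V} {c : V → Fin 3} (h : Split G s t c)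
    (hns : ∀ i v, cls c s t i ≠ {v}) : IsMinor H1 G ∨ IsMinor H2 G := by
  have hC : ∀ i j, i ≠ j → Disjoint (cls c s t i) (cls c s t j) := fun i j hij =>
    Set.disjoint_left.2 fun v hi hj => hij (hi.2.2.symm.trans hj.2.2)
  have hs : ∀ i, s ∉ cls c s t i := fun i hi => hi.1 rfl
  have ht : ∀ i, t ∉ cls c s t i := fun i hi => hi.2.1 rfl
  have hr : ∀ i, Rooted G s t (cls c s t i) ∨ Rooted G t s (cls c s t i) := fun i =>
    (h.good i).2.2.2.resolve_left fun ⟨v, hv⟩ => hns i v hv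
  have n01 : (0 : Fin 3) ≠ 1 := by decide
  have n02 : (0 : Fin 3) ≠ 2 := by decide
  have n12 : (1 : Fin 3) ≠ 2 := by decide
  rcases hr 0 with h0 | h0 <;> rcases hr 1 with h1 | h1 <;> rcases hr 2 with h2 | h2
  · exact .inl (isMinor_H1 h.ne hC hs ht fun i => by fin_cases i <;> assumption)
  · exact .inr (isMinor_H2 h.ne hC hs ht n01 n02 n12 h0 h1 h2)
  · exact .inr (isMinor_H2 h.ne hC hs ht n02 n01 n12.symm h0 h2 h1)
  · exact .inr (isMinor_H2 h.ne.symm hC ht hs n12 n01.symm n02.symm h1 h2 h0)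
  · exact .inr (isMinor_H2 h.ne hC hs ht n12 n01.symm n02.symm h1 h2 h0)
  · exact .inr (isMinor_H2 h.ne.symm hC ht hs n02 n01 n12.symm h0 h2 h1)
  · exact .inr (isMinor_H2 h.ne.symm hC ht hs n01 n02 n12 h0 h1 h2)
  · exact .inl (isMinor_H1 h.ne.symm hC ht hs fun i => by fin_cases i <;> assumption)

/-! ### Colour classes versus components, bridges and 2-cuts. -/

/-- The components of `G - {s, t}` are the classes of `c`. -/
lemma Split.image_supp {s t : V} {c : V → Fin 3} (h : Split G s t c)
    (v : ({s, t}ᶜ : Set V)) :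
    Subtype.val '' ((G.induce ({s, t}ᶜ : Set V)).connectedComponentMk v).supp =
      cls c s t (c v) := by
  have mem : ∀ w, w ∈ ({s, t}ᶜ : Set V) ↔ w ≠ s ∧ w ≠ t := by simp
  ext w
  constructor
  · rintro ⟨w, hw, rfl⟩
    have hr : (G.induce ({s, t}ᶜ : Set V)).Reachable w v := SimpleGraph.ConnectedComponent.exact hw
    have key : ∀ {a b : ({s, t}ᶜ : Set V)}, (G.induce ({s, t}ᶜ : Set V)).Walk a b → c a = c b := by
      intro a b p
      induction p with
      | nil => rfl
      | @cons a b _ hab _ ih =>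
        have ha := (mem a).1 a.2
        have hb := (mem b).1 b.2
        exact (h.cross a b hab ha.1 ha.2 hb.1 hb.2).trans ih
    exact ⟨((mem w).1 w.2).1, ((mem w).1 w.2).2, key hr.some⟩
  · intro hw
    obtain ⟨hw', hr⟩ := (h.good (c v)).1
      (fun x => ∃ hx : x ∈ ({s, t}ᶜ : Set V), (G.induce ({s, t}ᶜ : Set V)).Reachable v ⟨x, hx⟩)
      (fun a ha b hb hab ⟨_, hr⟩ =>
        ⟨(mem b).2 ⟨hb.1, hb.2.1⟩, hr.trans (SimpleGraph.Adj.reachable hab)⟩)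
      v ⟨((mem v).1 v.2).1, ((mem v).1 v.2).2, rfl⟩ w hw ⟨v.2, SimpleGraph.Reachable.refl _⟩
    exact ⟨⟨w, hw'⟩, SimpleGraph.ConnectedComponent.sound hr.symm, rfl⟩

lemma Split.hasP2_iff {s t : V} {c : V → Fin 3} (h : Split G s t c) :
    HasP2 G s t ↔ ∃ i v, cls c s t i = {v} := by
  have hdisj : ∀ i, Disjoint (cls c s t i) {s, t} := fun i => by
    rw [Set.disjoint_right]
    rintro v (rfl | rfl) hv
    · exact hv.1 rfl
    · exact hv.2.1 rfl
  have hpair := Set.ncard_pair h.ne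
  constructor
  · rintro ⟨_, ⟨C, rfl⟩, hB⟩
    induction C using SimpleGraph.ConnectedComponent.ind with | _ v
    rw [SimpleGraph.Subgraph.induce_verts, h.image_supp] at hB
    -- `Set.ncard` is zero on infinite sets, so the value three forces finiteness.
    have hfin : (cls c s t (c v)).Finite :=
      (Set.finite_of_ncard_ne_zero (by rw [hB]; simp)).subset Set.subset_union_left
    rw [Set.ncard_union_eq (hdisj _) hfin] at hB
    obtain ⟨w, hw⟩ := Set.ncard_eq_one.1 (show (cls c s t (c v)).ncard = 1 by omega)
    exact ⟨_, w, hw⟩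
  · rintro ⟨i, v, hv⟩
    have hvi : v ∈ cls c s t i := hv ▸ rfl
    have hv' : v ∈ ({s, t}ᶜ : Set V) := by simpa using ⟨hvi.1, hvi.2.1⟩
    refine ⟨_, ⟨(G.induce ({s, t}ᶜ : Set V)).connectedComponentMk ⟨v, hv'⟩, rfl⟩, ?_⟩
    rw [SimpleGraph.Subgraph.induce_verts, h.image_supp]
    have hd := hdisj i
    rw [← hvi.2.2] at hv hd
    rw [Set.ncard_union_eq hd (by rw [hv]; exact Set.finite_singleton v), hpair, hv,
      Set.ncard_singleton]

lemma Split.isTwoCut {s t : V} {c : V → Fin 3} (h : Split G s t c) (hG : ConnOn G Set.univ) :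
    IsTwoCut G s t := by
  refine ⟨h.ne, ?_⟩
  have hpre : G.Preconnected := fun v w =>
    (hG (fun x => G.Reachable v x) (fun a _ b _ hab hr => hr.trans hab.reachable) v trivial w
      trivial (SimpleGraph.Reachable.refl v))
  have : Subsingleton G.ConnectedComponent := hpre.subsingleton_connectedComponent
  have nonempty : ∀ i, ∃ v : ({s, t}ᶜ : Set V), c v = i := fun i => by
    obtain ⟨v, hv⟩ := (h.good i).2.1.nonempty_right
    exact ⟨⟨v, by simpa using ⟨hv.1, hv.2.1⟩⟩, hv.2.2⟩
  obtain ⟨v, hv⟩ := nonempty 0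
  obtain ⟨w, hw⟩ := nonempty 1
  have : Nontrivial (G.induce ({s, t}ᶜ : Set V)).ConnectedComponent := by
    refine ⟨(G.induce _).connectedComponentMk v, (G.induce _).connectedComponentMk w, fun e => ?_⟩
    have hw' : (w : V) ∈ cls c s t (c v) := by
      rw [← h.image_supp, e]
      exact ⟨w, rfl, rfl⟩
    simpa [hv, hw] using hw'.2.2
  exact (ENat.card_le_one_iff_subsingleton _ |>.2 ‹_›).trans_lt
    ((ENat.one_lt_card_iff_nontrivial _).2 ‹_›)

lemma IsTwoCut.exists_split {s t : V} (h : IsTwoCut G s t) (hG : IsSplittable G) :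
    ∃ c, Split G s t c := by
  have hn : ¬ ConnOn G {s, t}ᶜ := by
    intro hc
    have : Subsingleton (G.induce ({s, t}ᶜ : Set V)).ConnectedComponent :=
      hc.preconnected.subsingleton_connectedComponent
    have hlt : ENat.card G.ConnectedComponent <
        ENat.card (G.induce ({s, t}ᶜ : Set V)).ConnectedComponent := h.2
    -- If at most one component were left, `G` would have none, although it contains `s`.
    have h1 := hlt.trans_le (ENat.card_le_one_iff_subsingleton _ |>.2 this)
    have : IsEmpty G.ConnectedComponent := by
      simpa [Order.lt_one_iff, ENat.card_eq_zero_iff_empty] using h1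
    exact this.elim (G.connectedComponentMk s)
  by_cases hst : G.Adj s t
  · exact (hn (hG.edge s t hst).1).elim
  · exact (hG.pair s t h.1 hst).resolve_left hn

end GenTriangle

theorem lemma19 {V : Type*} (G : SimpleGraph V) (hG : GenTriangle.IsGeneralisedTriangle G) :
    GenTriangle.InK2 G ↔
      (¬ GenTriangle.IsMinor GenTriangle.H1 G ∧ ¬ GenTriangle.IsMinor GenTriangle.H2 G) := by
  constructor
  · rintro ⟨-, hK⟩
    have key : ¬ ∃ s t c, GenTriangle.Split G s t c ∧ ∀ i v, GenTriangle.cls c s t i ≠ {v} := by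
      rintro ⟨s, t, c, hc, hns⟩
      obtain ⟨i, v, hv⟩ := hc.hasP2_iff.1 (hK s t (hc.isTwoCut hG.isSplittable.conn))
      exact hns i v hv
    exact ⟨fun h => key (GenTriangle.exists_split_of_isMinor_H1 h hG.splitsThreeEdges),
      fun h => key (GenTriangle.exists_split_of_isMinor_H2 h hG.splitsThreeEdges)⟩
  · rintro ⟨h1, h2⟩
    refine ⟨hG, fun s t hst => ?_⟩
    obtain ⟨c, hc⟩ := hst.exists_split hG.isSplittable
    by_contra hP
    rcases hc.isMinor fun i v hv => hP (hc.hasP2_iff.2 ⟨i, v, hv⟩) with h | h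
    · exact h1 h
    · exact h2 h
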